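/- Let $m,N,K,M\ge 1$ be integers, $B=KN$, $d_e>0$ and $0<R<M$. Let $\mathcal X\subset\mathbb C$ be a finite constellation with $|\mathcal X|=2^M$, zero mean and unit average energy, and let $\mathbf M_1,\dots,\mathbf M_K\in\mathbb C^{N\times N}$ be unitary with full diversity: for all $s\ne s'$ in $\mathcal X^N$ and all $k$, every component of $\mathbf M_k(s-s')$ is non-zero. Consider the block-fading channel with $B$ sub-channels, one transmit and $m$ receive antennas, $\mathbf Y_i=\mathbf h_i\sqrt{P_i}\,\mathbf x_i^{T}+\mathbf W_i$, where $\mathbf W_i$ has i.i.d. $\mathcal{CN}(0,1)$ entries and $\mathbf h_1,\dots,\mathbf h_B\in\mathbb C^m$ have i.i.d. $\mathcal{CN}(0,1)$ entries. The receiver knows $\mathbf h_i$ and $P_i$; the transmitter knows $\widehat{\mathbf h}_i$, where $\mathbf h_i=\widehat{\mathbf h}_i+\mathbf e_i$, the estimates $\widehat{\mathbf h}_i$ have i.i.d. complex Gaussian entries and are independent of the noise vectors $\mathbf e_i$, which have i.i.d. $\mathcal{CN}(0,\mathrm{SNR}^{-d_e})$ entries. Put $\gamma_i=\|\mathbf h_i\|^2$,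 $\hat\gamma_i=\|\widehat{\mathbf h}_i\|^2$. The transmitted matrix is $\mathbf X=\operatorname{diag}(\mathbf M_1,\dots,\mathbf M_K)\,\mathbf S$, with symbols in $\mathbf S$ uniform on $\mathcal X$, so that the instantaneous mutual information is $$I=\frac1B\sum_{k=1}^K I(S^{(k)};Y^{(k)}),\qquad Y^{(k)}_j=\sqrt{P_i\gamma_i}\,(\mathbf M_kS^{(k)})_j+W^{(k)}_j,\quad i=(k-1)N+j,$$ where, for given $(P_i\gamma_i)_i$, $S^{(k)}$ is uniform on $\mathcal X^N$ and $W^{(k)}$ is an independent vector of i.i.d. $\mathcal{CN}(0,1)$ entries (information in bits). The powers are measurable functions $P_i=P_i(\hat\gamma_1,\dots,\hat\gamma_B)\ge0$ subject to the average constraint $\mathbb E\big[\frac1B\sum_iP_i\big]\le\mathrm{SNR}$ (there is no peak constraint). Let $P_{\rm out}(R)$ be the infimum of $\Pr\{I<R\}$ over all such power allocations. Then $$\lim_{\mathrm{SNR}\to\infty}-\frac{\log P_{\rm out}(R)}{\log \mathrm{SNR}}=m\,d^{\rm rot}_{\rm SB}\big(1+m\,d^{\rm rot}_{\rm SB}\,d_e\big),\qquad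 d^{\rm rot}_{\rm SB}=B+N-N\Big\lceil\frac{BR}{MN}\Big\rceil .$$ In particular, for $N=B$ the exponent is $mB(1+mB\,d_e)$. This is maximal: for every finite constellation with zero mean and unit average energy, every unitary $B\times B$ precoder and every $\varepsilon>0$, the infimum outage probability at rate $R$ is at least $\mathrm{SNR}^{-mB(1+mBd_e)-\varepsilon}$ for all sufficiently large $\mathrm{SNR}$. -/

import Mathlib

open MeasureTheory ProbabilityTheory Filter Topology
open scoped NNReal ENNReal

namespace BlockFading

/-- The circularly symmetric complex Gaussian law `CN(0, v)`: independent centred real and imaginary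
parts of variance `v / 2` each, so that `E |Z|² = v`. -/
noncomputable def complexGaussian (v : ℝ≥0) : Measure ℂ :=
  ((gaussianReal 0 (v / 2)).prod (gaussianReal 0 (v / 2))).map Complex.measurableEquivRealProd.symm

/-- A finite signal constellation with zero mean and unit average energy (uniform symbols). -/
def IsNormalized (X : Finset ℂ) : Prop :=
  ∑ x ∈ X, x = 0 ∧ (X.card : ℝ)⁻¹ * ∑ x ∈ X, ‖x‖ ^ 2 = 1

/-- Full diversity of a rotation `U` over the constellation `X`: two distinct symbol vectors
are mapped to vectors that differ in every component. -/
def IsFullDiversity {N : ℕ} (X : Finset ℂ) (U : Matrix (Fin N) (Fin N) ℂ) : Prop :=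
  ∀ s s' : Fin N → ℂ, (∀ j, s j ∈ X) → (∀ j, s' j ∈ X) → s ≠ s' →
    ∀ j, (U.mulVec (s - s')) j ≠ 0

/-- The noiseless output of `N` parallel sub-channels with signal-to-noise ratios `a j`, when the
symbol vector `s` is precoded by `U`. -/
noncomputable def received {N : ℕ} (U : Matrix (Fin N) (Fin N) ℂ) (a : Fin N → ℝ)
    (s : Fin N → ℂ) : Fin N → ℂ :=
  fun j => (Real.sqrt (a j) : ℂ) * U.mulVec s j

/-- The unnormalized likelihood `exp (-‖y - z‖²)` (Euclidean norm) of the output `y` of the channel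
with unit-variance complex Gaussian noise when its noiseless output is `z`. -/
noncomputable def likelihood {N : ℕ} (y z : Fin N → ℂ) : ℝ :=
  Real.exp (-∑ j, ‖y j - z j‖ ^ 2)

/-- Mutual information, in bits, between a vector `S` uniformly distributed on `X ^ N` and
`Y = diag (√a) U S + W`, where `W` has i.i.d. `CN(0, 1)` components independent of `S`:
`E [log₂ (exp (-‖Y - diag (√a) U S‖²) / ∑_{s'} |X|^{-N} exp (-‖Y - diag (√a) U s'‖²))]`. -/
noncomputable def groupInfo {N : ℕ} (X : Finset ℂ) (U : Matrix (Fin N) (Fin N) ℂ)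
    (a : Fin N → ℝ) : ℝ :=
  ((X.card : ℝ) ^ N)⁻¹ * ∑ s ∈ Fintype.piFinset (fun _ : Fin N => X),
    ∫ w : Fin N → ℂ,
      Real.logb 2
        (likelihood (received U a s + w) (received U a s) /
          (((X.card : ℝ) ^ N)⁻¹ * ∑ s' ∈ Fintype.piFinset (fun _ : Fin N => X),
            likelihood (received U a s + w) (received U a s')))
      ∂(Measure.pi fun _ : Fin N => complexGaussian 1)

/-- Instantaneous mutual information per channel use of the block-fading channel with `B = K * N`
sub-channels, indexed by pairs (group, position in the group), whose `k`-th group of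
`N` sub-channels is precoded by `U k`; `a i` is the instantaneous SNR of sub-channel `i`. -/
noncomputable def instInfo {K N : ℕ} (X : Finset ℂ) (U : Fin K → Matrix (Fin N) (Fin N) ℂ)
    (a : Fin K × Fin N → ℝ) : ℝ :=
  ((K * N : ℕ) : ℝ)⁻¹ * ∑ k, groupInfo X (U k) (fun j => a (k, j))

/-- Coefficient vectors of all `K * N` sub-channels with `m` receive antennas. -/
abbrev Gains (m K N : ℕ) : Type := Fin K × Fin N → Fin m → ℂ

/-- The law with all coefficients i.i.d. `CN(0, v)`. -/
noncomputable def iidGains (m K N : ℕ) (v : ℝ≥0) : Measure (Gains m K N) :=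
  Measure.pi fun _ => Measure.pi fun _ => complexGaussian v

/-- The variance `ρ ^ (-de)` of the CSIT noise at signal-to-noise ratio `ρ`. -/
noncomputable def csitNoiseVar (de ρ : ℝ) : ℝ≥0 := (ρ ^ (-de)).toNNReal

/-- Joint law of the channel estimate and the CSIT noise `(ĥ, e)`: they are independent, `e` has
i.i.d. `CN(0, ρ ^ (-de))` entries, and `ĥ` has i.i.d. entries of variance `1 - ρ ^ (-de)`, so that
`h = ĥ + e` has i.i.d. `CN(0, 1)` entries (for `ρ ≥ 1`; only large `ρ` matter). -/
noncomputable def csitLaw (m K N : ℕ) (de ρ : ℝ) : Measure (Gains m K N × Gains m K N) :=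
  (iidGains m K N (1 - csitNoiseVar de ρ)).prod (iidGains m K N (csitNoiseVar de ρ))

/-- The fading magnitudes `‖h_i‖²` of the sub-channels. -/
noncomputable def fading {m K N : ℕ} (h : Gains m K N) : Fin K × Fin N → ℝ :=
  fun i => ∑ r, ‖h i r‖ ^ 2

/-- Power allocation rules `P_i (γ̂)` as functions of the estimated fading magnitudes, nonnegative
and with `E [(1 / B) ∑ P_i (γ̂)] ≤ ρ`. -/
def IsPowerRule (m K N : ℕ) (de ρ : ℝ)
    (P : (Fin K × Fin N → ℝ) → (Fin K × Fin N → ℝ)) : Prop :=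
  Measurable P ∧ (∀ g i, 0 ≤ P g i) ∧
    ∫⁻ ω, ENNReal.ofReal (((K * N : ℕ) : ℝ)⁻¹ * ∑ i, P (fading ω.1) i) ∂(csitLaw m K N de ρ)
      ≤ ENNReal.ofReal ρ

/-- Probability that the instantaneous mutual information, at the SNRs `P_i (γ̂) γ_i`, is below the
rate `R`, when the power allocation rule `P` is used. -/
noncomputable def outageProb (m : ℕ) {K N : ℕ} (X : Finset ℂ)
    (U : Fin K → Matrix (Fin N) (Fin N) ℂ) (R de ρ : ℝ)
    (P : (Fin K × Fin N → ℝ) → (Fin K × Fin N → ℝ)) : ℝ≥0∞ :=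
  csitLaw m K N de ρ
    {ω | instInfo X U (fun i => P (fading ω.1) i * fading (ω.1 + ω.2) i) < R}

/-- The outage probability of optimal power control: the infimum over all admissible power
allocation rules at signal-to-noise ratio `ρ`. -/
noncomputable def minOutage (m : ℕ) {K N : ℕ} (X : Finset ℂ)
    (U : Fin K → Matrix (Fin N) (Fin N) ℂ) (R de ρ : ℝ) : ℝ :=
  (⨅ (P : (Fin K × Fin N → ℝ) → (Fin K × Fin N → ℝ)) (_ : IsPowerRule m K N de ρ P),
    outageProb m X U R de ρ P).toReal

/-- `d` is the SNR exponent of the outage probability under optimal power control. -/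
def HasOutageExponent (m : ℕ) {K N : ℕ} (X : Finset ℂ)
    (U : Fin K → Matrix (Fin N) (Fin N) ℂ) (R de d : ℝ) : Prop :=
  Tendsto (fun ρ : ℝ => -Real.log (minOutage m X U R de ρ) / Real.log ρ) atTop (𝓝 d)

/-- The Singleton-type bound `B + N - N ⌈B R / (M N)⌉` for rotations of dimension `N`. -/
noncomputable def dSBrot (B N M : ℕ) (R : ℝ) : ℝ :=
  (B : ℝ) + N - N * (⌈(B : ℝ) * R / ((M : ℝ) * N)⌉ : ℤ)

end BlockFading

open BlockFading

namespace BlockFading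

/-! Write `c = ⌈KR/M⌉`, `n = K + 1 - c` and `D = m n N`, so that `D` is `m` times the Singleton-type
bound; the exponent to prove is `D (1 + D de)`. The mutual information enters only through a
dichotomy. If all sub-channels of some `n` groups have small instantaneous SNR, the other `c - 1`
groups carry at most `NM` bits each, which is not enough (`exists_forall_instInfo_lt`). Conversely,
by full diversity a single strong sub-channel nearly saturates its group, so `c` groups with a
strong sub-channel suffice, provided no sub-channel is absurdly weak (`eventually_le_instInfo`).
Both halves rest on elementary bounds for a uniform input: the cutoff rate from below and a `χ²`
divergence from above. Outage is thus essentially a deep fade of the `n N` sub-channels of `n`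
groups, and a fade below `x` of `n N` Gaussian vectors of variance `v` in `ℂ^m` has probability of
order `(x / v) ^ D` for `x ≤ v`, if the vectors are centred within distance of order `√v` of the
origin.

Converse (`exists_const_mul_rpow_le_minOutage`). With probability of order `ρ ^ (-D de)` the
estimates of `n` groups are all below the CSIT noise level. By Markov's inequality, on at least half
of the probability guaranteed for this event, the power is at most of order `ρ ^ (1 + D de)`. There
the CSIT noise can still cancel the estimate and push the true gains below the inverse of that
power; relative to the noise variance this costs `ρ ^ (-D (1 + D de - de))`. The two factors
multiply to `ρ ^ (-D (1 + D de))`.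

Achievability (`eventually_minOutage_le`). The power is inversely proportional to the probability of
the estimated fade, on a finite grid of depths reaching almost to `ρ ^ (-de)`; the average then
stays of order `ρ`. If the estimate is above the last level, the CSIT noise is too small, outside an
event of superpolynomially small probability, to hide a true deep fade. Below that level the power
is almost `ρ ^ (1 + D de)`, and the probability is bounded by the same product as in the converse,
up to `ρ ^ ε`. -/

instance (v : ℝ≥0) : IsProbabilityMeasure (complexGaussian v) :=
  Measure.isProbabilityMeasure_map (MeasurableEquiv.measurable _).aemeasurable

instance (m K N : ℕ) (v : ℝ≥0) : IsProbabilityMeasure (iidGains m K N v) := by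
  unfold iidGains; infer_instance

instance (m K N : ℕ) (de ρ : ℝ) : IsProbabilityMeasure (csitLaw m K N de ρ) := by
  unfold csitLaw; infer_instance

theorem measurable_fading {m K N : ℕ} : Measurable (fading : Gains m K N → _) := by
  unfold fading; fun_prop

/-! ### Small-ball and tail estimates for complex Gaussian vectors -/

theorem complexGaussian_reProdIm (v : ℝ≥0) (s t : Set ℝ) :
    complexGaussian v {z | z.re ∈ s ∧ z.im ∈ t} =
      gaussianReal 0 (v / 2) s * gaussianReal 0 (v / 2) t := by
  rw [complexGaussian, MeasurableEquiv.map_apply, ← Measure.prod_prod]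
  congr 1

/-- The density is at most `1 / √(π v)`, uniformly in the centre `a`. The square root form makes the
product over real and imaginary parts rational. -/
theorem gaussianReal_Icc_le {v : ℝ≥0} (hv : v ≠ 0) (a y : ℝ) :
    gaussianReal 0 (v / 2) (Set.Icc (a - y) (a + y)) ≤ ENNReal.ofReal (Real.sqrt (2 * y ^ 2 / v)) := by
  have hv' : (0 : ℝ) < v := by positivity
  rw [gaussianReal_apply _ (by positivity)]
  calc ∫⁻ x in Set.Icc (a - y) (a + y), gaussianPDF 0 (v / 2) x
      ≤ ∫⁻ x in Set.Icc (a - y) (a + y), ENNReal.ofReal (Real.sqrt (Real.pi * v))⁻¹ := by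
        refine lintegral_mono fun x => ?_
        rw [gaussianPDF_def]
        refine ENNReal.ofReal_le_ofReal ?_
        rw [gaussianPDFReal_def]
        have : 2 * Real.pi * ((v / 2 : ℝ≥0) : ℝ) = Real.pi * v := by push_cast; ring
        rw [this]
        refine mul_le_of_le_one_right (by positivity) (Real.exp_le_one_iff.2 ?_)
        rw [neg_div]
        exact neg_nonpos.2 (by positivity)
    _ = ENNReal.ofReal ((Real.sqrt (Real.pi * v))⁻¹ * (2 * y)) := by
        rw [lintegral_const, Measure.restrict_apply_univ, Real.volume_Icc,
          ← ENNReal.ofReal_mul (by positivity)]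
        congr 2; ring
    _ ≤ _ := by
        refine ENNReal.ofReal_le_ofReal (Real.le_sqrt_of_sq_le ?_)
        rw [mul_pow, inv_pow, Real.sq_sqrt (by positivity), inv_mul_eq_div]
        rw [div_le_div_iff₀ (by positivity) hv']
        nlinarith [Real.pi_gt_three, mul_nonneg (sq_nonneg y) hv'.le]

theorem le_gaussianReal_Icc {v : ℝ≥0} (hv : v ≠ 0) {a y : ℝ} (ha : a ^ 2 ≤ v) (hy : 0 ≤ y)
    (hyv : y ^ 2 ≤ v) :
    ENNReal.ofReal (Real.sqrt (y ^ 2 / v) * Real.exp (-4)) ≤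
      gaussianReal 0 (v / 2) (Set.Icc (a - y) (a + y)) := by
  have hv' : (0 : ℝ) < v := by positivity
  rw [gaussianReal_apply _ (by positivity)]
  calc _ ≤ ENNReal.ofReal ((Real.sqrt (Real.pi * v))⁻¹ * Real.exp (-4) * (2 * y)) := by
        refine ENNReal.ofReal_le_ofReal ?_
        have : Real.sqrt (y ^ 2 / v) ≤ (Real.sqrt (Real.pi * v))⁻¹ * (2 * y) := by
          refine Real.sqrt_le_iff.2 ⟨by positivity, ?_⟩
          rw [mul_pow, inv_pow, Real.sq_sqrt (by positivity), inv_mul_eq_div]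
          rw [div_le_div_iff₀ hv' (by positivity)]
          nlinarith [Real.pi_lt_four, mul_nonneg (sq_nonneg y) hv'.le]
        nlinarith [Real.exp_pos (-4)]
    _ = ∫⁻ x in Set.Icc (a - y) (a + y),
          ENNReal.ofReal ((Real.sqrt (Real.pi * v))⁻¹ * Real.exp (-4)) := by
        rw [lintegral_const, Measure.restrict_apply_univ, Real.volume_Icc,
          ← ENNReal.ofReal_mul (by positivity)]
        congr 2; ring
    _ ≤ _ := by
        refine setLIntegral_mono (measurable_gaussianPDF _ _) fun x hx => ?_
        rw [gaussianPDF_def]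
        refine ENNReal.ofReal_le_ofReal ?_
        rw [gaussianPDFReal_def]
        have : 2 * Real.pi * ((v / 2 : ℝ≥0) : ℝ) = Real.pi * v := by push_cast; ring
        rw [this]
        refine mul_le_mul_of_nonneg_left (Real.exp_le_exp.2 ?_) (by positivity)
        have h2 : 2 * ((v / 2 : ℝ≥0) : ℝ) = v := by push_cast; ring
        rw [h2, sub_zero, neg_div, neg_le_neg_iff, div_le_iff₀ hv']
        have h1 : (x - a) ^ 2 ≤ y ^ 2 := sq_le_sq' (by linarith [hx.1]) (by linarith [hx.2])
        -- This is `x² ≤ 2 (x - a)² + 2 a² ≤ 4 v`, the origin of the factor `exp (-4)`.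
        nlinarith [sq_nonneg (x - 2 * a)]

theorem gaussianReal_sq_gt_le {v : ℝ≥0} {y : ℝ} (hy : 0 ≤ y) :
    gaussianReal 0 (v / 2) {x | y < x ^ 2} ≤ ENNReal.ofReal (2 * Real.exp (-(y / v))) := by
  have hG : HasSubgaussianMGF (fun x : ℝ => x) (v / 2) (gaussianReal 0 (v / 2)) :=
    ⟨fun t => integrable_exp_mul_gaussianReal t, fun t => by
      rw [mgf_fun_id_gaussianReal]; simp⟩
  have h1 := hG.measure_ge_le (Real.sqrt_nonneg y)
  have h2 := hG.neg.measure_ge_le (Real.sqrt_nonneg y)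
  have he : -Real.sqrt y ^ 2 / (2 * ((v / 2 : ℝ≥0) : ℝ)) = -(y / v) := by
    rw [Real.sq_sqrt hy, neg_div]
    congr 2
    push_cast; ring
  rw [he] at h1 h2
  have hsub : {x : ℝ | y < x ^ 2} ⊆ {x | Real.sqrt y ≤ x} ∪ {x | Real.sqrt y ≤ (-fun x : ℝ => x) x} := by
    intro x hx
    have := Real.sqrt_le_sqrt (le_of_lt hx)
    rw [Real.sqrt_sq_eq_abs] at this
    exact (le_abs.1 this)
  refine (ENNReal.le_ofReal_iff_toReal_le (measure_ne_top _ _) (by positivity)).2 ?_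
  change (gaussianReal 0 (v / 2)).real _ ≤ _
  calc _ ≤ (gaussianReal 0 (v / 2)).real _ := measureReal_mono hsub
    _ ≤ _ := measureReal_union_le _ _
    _ ≤ _ := by linarith

/-- The law of `m` i.i.d. complex Gaussian coefficients. -/
noncomputable abbrev gaussianVec (m : ℕ) (v : ℝ≥0) : Measure (Fin m → ℂ) :=
  Measure.pi fun _ => complexGaussian v

theorem sq_re_le (z : ℂ) : z.re ^ 2 ≤ ‖z‖ ^ 2 := by
  rw [Complex.sq_norm, Complex.normSq_apply]; nlinarith [sq_nonneg z.im]

theorem sq_im_le (z : ℂ) : z.im ^ 2 ≤ ‖z‖ ^ 2 := by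
  rw [Complex.sq_norm, Complex.normSq_apply]; nlinarith [sq_nonneg z.re]

theorem norm_sq_eq_re_im (z : ℂ) : ‖z‖ ^ 2 = z.re ^ 2 + z.im ^ 2 := by
  rw [Complex.sq_norm, Complex.normSq_apply]; ring

theorem complexGaussian_ball_le {v : ℝ≥0} (hv : v ≠ 0) (z : ℂ) {x : ℝ} (hx : 0 ≤ x) :
    complexGaussian v {e | ‖z + e‖ ^ 2 < x} ≤ ENNReal.ofReal (2 * x / v) := by
  have hmono : {e : ℂ | ‖z + e‖ ^ 2 < x} ⊆
      {e | e.re ∈ Set.Icc (-z.re - √x) (-z.re + √x) ∧ e.im ∈ Set.Icc (-z.im - √x) (-z.im + √x)} := by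
    intro e he
    have h1 := abs_le.1 (Real.abs_le_sqrt ((sq_re_le (z + e)).trans he.le))
    have h2 := abs_le.1 (Real.abs_le_sqrt ((sq_im_le (z + e)).trans he.le))
    simp only [Complex.add_re, Complex.add_im] at h1 h2
    refine ⟨⟨?_, ?_⟩, ⟨?_, ?_⟩⟩ <;> linarith [h1.1, h1.2, h2.1, h2.2]
  refine (measure_mono hmono).trans ?_
  rw [complexGaussian_reProdIm]
  refine (mul_le_mul' (gaussianReal_Icc_le hv _ _)
    (gaussianReal_Icc_le hv _ _)).trans ?_
  rw [← ENNReal.ofReal_mul (Real.sqrt_nonneg _), Real.mul_self_sqrt (by positivity),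
    Real.sq_sqrt hx]

theorem le_complexGaussian_ball {v : ℝ≥0} (hv : v ≠ 0) {z : ℂ} (hz : ‖z‖ ^ 2 ≤ v) {x : ℝ}
    (hx : 0 ≤ x) (hxv : x ≤ v) :
    ENNReal.ofReal (Real.exp (-8) / 2 * (x / v)) ≤ complexGaussian v {e | ‖z + e‖ ^ 2 ≤ x} := by
  have hmono : {e : ℂ | e.re ∈ Set.Icc (-z.re - √(x / 2)) (-z.re + √(x / 2)) ∧
      e.im ∈ Set.Icc (-z.im - √(x / 2)) (-z.im + √(x / 2))} ⊆ {e : ℂ | ‖z + e‖ ^ 2 ≤ x} := by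
    rintro e ⟨⟨h1, h2⟩, ⟨h3, h4⟩⟩
    have hs := Real.sq_sqrt (show 0 ≤ x / 2 by positivity)
    have h5 : (z.re + e.re) ^ 2 ≤ √(x / 2) ^ 2 := sq_le_sq' (by linarith) (by linarith)
    have h6 : (z.im + e.im) ^ 2 ≤ √(x / 2) ^ 2 := sq_le_sq' (by linarith) (by linarith)
    simp only [Set.mem_ofPred_eq, norm_sq_eq_re_im, Complex.add_re, Complex.add_im]
    linarith
  refine le_trans ?_ (measure_mono hmono)
  rw [complexGaussian_reProdIm]
  have hs := Real.sq_sqrt (show 0 ≤ x / 2 by positivity)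
  have hy : √(x / 2) ^ 2 ≤ v := by rw [hs]; linarith
  refine le_trans ?_ (mul_le_mul'
    (le_gaussianReal_Icc hv (a := -z.re) (by rw [neg_sq]; exact (sq_re_le z).trans hz)
      (Real.sqrt_nonneg _) hy)
    (le_gaussianReal_Icc hv (a := -z.im) (by rw [neg_sq]; exact (sq_im_le z).trans hz)
      (Real.sqrt_nonneg _) hy))
  rw [← ENNReal.ofReal_mul (by positivity), hs]
  refine ENNReal.ofReal_le_ofReal (le_of_eq ?_)
  rw [mul_mul_mul_comm, Real.mul_self_sqrt (by positivity), ← Real.exp_add]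
  norm_num
  ring

theorem complexGaussian_tail_le {v : ℝ≥0} {y : ℝ} (hy : 0 ≤ y) :
    complexGaussian v {e | y < ‖e‖ ^ 2} ≤ ENNReal.ofReal (4 * Real.exp (-(y / (2 * v)))) := by
  have hmono : {e : ℂ | y < ‖e‖ ^ 2} ⊆
      {e | e.re ∈ {x : ℝ | y / 2 < x ^ 2} ∧ e.im ∈ Set.univ} ∪
      {e | e.re ∈ Set.univ ∧ e.im ∈ {x : ℝ | y / 2 < x ^ 2}} := by
    intro e he
    simp only [Set.mem_ofPred_eq, norm_sq_eq_re_im] at he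
    simp only [Set.mem_union, Set.mem_ofPred_eq, Set.mem_univ, and_true, true_and]
    by_contra! h
    linarith
  refine (measure_mono hmono).trans ((measure_union_le _ _).trans ?_)
  rw [complexGaussian_reProdIm, complexGaussian_reProdIm]
  simp only [measure_univ, mul_one, one_mul]
  refine (add_le_add (gaussianReal_sq_gt_le (by positivity))
    (gaussianReal_sq_gt_le (by positivity))).trans ?_
  rw [← ENNReal.ofReal_add (by positivity) (by positivity), div_div]
  refine ENNReal.ofReal_le_ofReal (le_of_eq (by ring))

theorem gaussianVec_ball_le {m : ℕ} {v : ℝ≥0} (hv : v ≠ 0) (z : Fin m → ℂ) {x : ℝ} (hx : 0 ≤ x) :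
    gaussianVec m v {e | ∑ r, ‖z r + e r‖ ^ 2 < x} ≤ ENNReal.ofReal ((2 * x / v) ^ m) := by
  have hmono : {e : Fin m → ℂ | ∑ r, ‖z r + e r‖ ^ 2 < x} ⊆
      Set.univ.pi fun r => {e | ‖z r + e‖ ^ 2 < x} := fun e he r _ =>
    (Finset.single_le_sum (f := fun r => ‖z r + e r‖ ^ 2) (fun _ _ => by positivity)
      (Finset.mem_univ r)).trans_lt he
  refine (measure_mono hmono).trans ?_
  rw [Measure.pi_pi]
  refine (Finset.prod_le_prod' fun r _ => complexGaussian_ball_le hv (z r) hx).trans ?_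
  rw [Finset.prod_const, ENNReal.ofReal_pow (by positivity), Finset.card_univ, Fintype.card_fin]

theorem le_gaussianVec_ball {m : ℕ} {v : ℝ≥0} (hv : v ≠ 0) {z : Fin m → ℂ}
    (hz : ∑ r, ‖z r‖ ^ 2 ≤ v) {x : ℝ} (hx : 0 ≤ x) (hxv : x ≤ v) :
    ENNReal.ofReal ((Real.exp (-8) / (2 * m) * (x / v)) ^ m) ≤
      gaussianVec m v {e | ∑ r, ‖z r + e r‖ ^ 2 ≤ x} := by
  rcases Nat.eq_zero_or_pos m with rfl | hm
  · simp [hx]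
  have hm1 : (1 : ℝ) ≤ m := by exact_mod_cast hm
  have hmono : (Set.univ.pi fun r => {e | ‖z r + e‖ ^ 2 ≤ x / m}) ⊆
      {e : Fin m → ℂ | ∑ r, ‖z r + e r‖ ^ 2 ≤ x} := fun e he => by
    calc ∑ r, ‖z r + e r‖ ^ 2 ≤ ∑ _r : Fin m, x / m :=
          Finset.sum_le_sum fun r _ => he r (Set.mem_univ r)
      _ = x := by
        rw [Finset.sum_const, Finset.card_univ, Fintype.card_fin, nsmul_eq_mul]
        field_simp
  refine le_trans ?_ (measure_mono hmono)
  rw [Measure.pi_pi, ENNReal.ofReal_pow (by positivity)]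
  have hxm : x / m ≤ v := (div_le_self hx hm1).trans hxv
  refine le_trans (le_of_eq ?_) (Finset.prod_le_prod' fun r _ => le_complexGaussian_ball hv
    ((Finset.single_le_sum (f := fun r => ‖z r‖ ^ 2) (fun _ _ => by positivity)
      (Finset.mem_univ r)).trans hz) (by positivity) hxm)
  rw [Finset.prod_const, Finset.card_univ, Fintype.card_fin]
  congr 2
  field_simp

theorem gaussianVec_tail_le {m : ℕ} {v : ℝ≥0} {y : ℝ} (hy : 0 ≤ y) :
    gaussianVec m v {e | y < ∑ r, ‖e r‖ ^ 2} ≤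
      ENNReal.ofReal (m * (4 * Real.exp (-(y / (2 * m * v))))) := by
  have hmono : {e : Fin m → ℂ | y < ∑ r, ‖e r‖ ^ 2} ⊆
      ⋃ r, (fun e => e r) ⁻¹' {e : ℂ | y / m < ‖e‖ ^ 2} := by
    intro e he
    by_contra h
    simp only [Set.mem_iUnion, Set.mem_preimage, Set.mem_ofPred_eq, not_exists, not_lt] at h
    have : ∑ r, ‖e r‖ ^ 2 ≤ ∑ _r : Fin m, y / m := Finset.sum_le_sum fun r _ => h r
    rw [Finset.sum_const, Finset.card_univ, Fintype.card_fin, nsmul_eq_mul] at this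
    have h2 : (m : ℝ) * (y / m) ≤ y := by
      rcases Nat.eq_zero_or_pos m with rfl | hm
      · simpa using hy
      · have : (0 : ℝ) < m := by exact_mod_cast hm
        field_simp; exact le_rfl
    exact absurd he (not_lt.2 (this.trans h2))
  have hms : MeasurableSet {e : ℂ | y / m < ‖e‖ ^ 2} :=
    measurableSet_lt measurable_const (by fun_prop)
  refine (measure_mono hmono).trans ((measure_iUnion_fintype_le _ _).trans ?_)
  calc _ ≤ ∑ _r : Fin m, ENNReal.ofReal (4 * Real.exp (-(y / m / (2 * v)))) := by
        refine Finset.sum_le_sum fun r _ => ?_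
        rw [(measurePreserving_eval (fun _ : Fin m => complexGaussian v) r).measure_preimage
          hms.nullMeasurableSet]
        exact complexGaussian_tail_le (by positivity)
    _ = _ := by
        rw [Finset.sum_const, Finset.card_univ, Fintype.card_fin, nsmul_eq_mul,
          ← ENNReal.ofReal_natCast, ← ENNReal.ofReal_mul (by positivity), div_div]
        congr 6; ring

/-- Independence of the sub-channels: this is what turns a joint fade of `S` into a power with
exponent `m * S.card`. -/
theorem iidGains_forall {m K N : ℕ} (v : ℝ≥0) (S : Finset (Fin K × Fin N))
    (A : Fin K × Fin N → Set (Fin m → ℂ)) :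
    iidGains m K N v {e | ∀ i ∈ S, e i ∈ A i} = ∏ i ∈ S, gaussianVec m v (A i) := by
  classical
  have : {e : Gains m K N | ∀ i ∈ S, e i ∈ A i} =
      Set.univ.pi fun i => if i ∈ S then A i else Set.univ := by
    ext e
    simp only [Set.mem_ofPred_eq, Set.mem_pi, Set.mem_univ, true_imp_iff]
    refine forall_congr' fun i => ?_
    split_ifs with h <;> simp [h]
  rw [this, iidGains, Measure.pi_pi]
  rw [← Finset.prod_subset (Finset.subset_univ S)]
  · exact Finset.prod_congr rfl fun i hi => by rw [if_pos hi]
  · intro i _ hi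
    rw [if_neg hi, measure_univ]

theorem iidGains_forall_fading_lt_le {m K N : ℕ} {v : ℝ≥0} (hv : v ≠ 0) (z : Gains m K N)
    (S : Finset (Fin K × Fin N)) {x : ℝ} (hx : 0 ≤ x) :
    iidGains m K N v {e | ∀ i ∈ S, fading (z + e) i < x} ≤
      ENNReal.ofReal ((2 * x / v) ^ (m * S.card)) := by
  refine (iidGains_forall v S fun i => {e | ∑ r, ‖z i r + e r‖ ^ 2 < x}).le.trans ?_
  refine (Finset.prod_le_prod' fun i _ => gaussianVec_ball_le hv (z i) hx).trans ?_
  rw [Finset.prod_const, ← ENNReal.ofReal_pow (by positivity), pow_mul]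

theorem le_iidGains_forall_fading_le {m K N : ℕ} {v : ℝ≥0} (hv : v ≠ 0) {z : Gains m K N}
    {S : Finset (Fin K × Fin N)} (hz : ∀ i ∈ S, fading z i ≤ v) {x : ℝ} (hx : 0 ≤ x)
    (hxv : x ≤ v) :
    ENNReal.ofReal ((Real.exp (-8) / (2 * m) * (x / v)) ^ (m * S.card)) ≤
      iidGains m K N v {e | ∀ i ∈ S, fading (z + e) i ≤ x} := by
  refine le_trans ?_ (iidGains_forall v S fun i => {e | ∑ r, ‖z i r + e r‖ ^ 2 ≤ x}).ge
  refine le_trans (le_of_eq ?_)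
    (Finset.prod_le_prod' fun i hi => le_gaussianVec_ball hv (hz i hi) hx hxv)
  rw [Finset.prod_const, ← ENNReal.ofReal_pow (by positivity), pow_mul]

theorem iidGains_exists_fading_gt_le {m K N : ℕ} {v : ℝ≥0} {y : ℝ} (hy : 0 ≤ y) :
    iidGains m K N v {e | ∃ i, y < fading e i} ≤
      ENNReal.ofReal ((K * N : ℕ) * (m * (4 * Real.exp (-(y / (2 * m * v)))))) := by
  have : {e : Gains m K N | ∃ i, y < fading e i} =
      ⋃ i, (fun e => e i) ⁻¹' {e : Fin m → ℂ | y < ∑ r, ‖e r‖ ^ 2} := by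
    ext e; simp [fading]
  have hms : MeasurableSet {e : Fin m → ℂ | y < ∑ r, ‖e r‖ ^ 2} :=
    measurableSet_lt measurable_const (by fun_prop)
  rw [this]
  refine (measure_iUnion_fintype_le _ _).trans ?_
  refine (Finset.sum_le_card_nsmul _ _ (ENNReal.ofReal (m * (4 * Real.exp (-(y / (2 * m * v))))))
    fun i _ => ?_).trans (le_of_eq ?_)
  · rw [iidGains, (measurePreserving_eval (fun _ : Fin K × Fin N => gaussianVec m v) i).measure_preimage
      hms.nullMeasurableSet]
    exact gaussianVec_tail_le hy
  · rw [Finset.card_univ, Fintype.card_prod, Fintype.card_fin, Fintype.card_fin, nsmul_eq_mul,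
      ← ENNReal.ofReal_natCast, ← ENNReal.ofReal_mul (by positivity)]

theorem iidGains_exists_fading_lt_le {m K N : ℕ} {v : ℝ≥0} (hv : v ≠ 0) (z : Gains m K N)
    {x : ℝ} (hx : 0 ≤ x) :
    iidGains m K N v {e | ∃ i, fading (z + e) i < x} ≤
      ENNReal.ofReal ((K * N : ℕ) * (2 * x / v) ^ m) := by
  have : {e : Gains m K N | ∃ i, fading (z + e) i < x} =
      ⋃ i, {e | ∀ j ∈ ({i} : Finset (Fin K × Fin N)), fading (z + e) j < x} := by
    ext e; simp
  rw [this]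
  refine (measure_iUnion_fintype_le _ _).trans ?_
  refine (Finset.sum_le_card_nsmul _ _ (ENNReal.ofReal ((2 * x / v) ^ m))
    fun i _ => ?_).trans (le_of_eq ?_)
  · refine (iidGains_forall_fading_lt_le hv z {i} hx).trans (le_of_eq ?_)
    simp
  · rw [Finset.card_univ, Fintype.card_prod, Fintype.card_fin, Fintype.card_fin, nsmul_eq_mul,
      ← ENNReal.ofReal_natCast, ← ENNReal.ofReal_mul (by positivity)]

/-! ### Mutual information of a uniform input on a finite alphabet -/

section UniformInput

variable {Y ι : Type*} {S : Finset ι} {p : ι → Y → ℝ}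

/-- The output density when the input is uniform on `S`. -/
noncomputable def mixture (S : Finset ι) (p : ι → Y → ℝ) (y : Y) : ℝ :=
  (S.card : ℝ)⁻¹ * ∑ s ∈ S, p s y

theorem mixture_pos (hS : S.Nonempty) (hp : ∀ s y, 0 < p s y) (y : Y) : 0 < mixture S p y :=
  mul_pos (by have := hS.card_pos; positivity) (Finset.sum_pos (fun s _ => hp s y) hS)

theorem sum_eq_card_mul_mixture (hS : S.Nonempty) (y : Y) :
    ∑ s ∈ S, p s y = S.card * mixture S p y := by
  have := hS.card_pos
  rw [mixture, mul_inv_cancel_left₀ (by positivity)]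

theorem le_card_mul_mixture (hp : ∀ s y, 0 < p s y) {s : ι} (hs : s ∈ S) (y : Y) :
    p s y ≤ S.card * mixture S p y := by
  rw [← sum_eq_card_mul_mixture ⟨s, hs⟩]
  exact Finset.single_le_sum (f := fun s => p s y) (fun _ _ => (hp _ y).le) hs

theorem log_div_mixture_le (hp : ∀ s y, 0 < p s y) {s : ι} (hs : s ∈ S) (y : Y) :
    Real.log (p s y / mixture S p y) ≤ Real.log S.card := by
  have hq := mixture_pos ⟨s, hs⟩ hp y
  refine Real.log_le_log (div_pos (hp s y) hq) ?_
  rw [div_le_iff₀ hq]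
  exact le_card_mul_mixture hp hs y

variable [MeasurableSpace Y] {μ : Measure Y}

theorem integrable_mixture (hint : ∀ s, Integrable (p s) μ) : Integrable (mixture S p) μ :=
  (integrable_finsetSum _ fun s _ => hint s).const_mul _

theorem integral_mixture (hS : S.Nonempty) (hint : ∀ s, Integrable (p s) μ)
    (hone : ∀ s, ∫ y, p s y ∂μ = 1) : ∫ y, mixture S p y ∂μ = 1 := by
  have := hS.card_pos
  simp only [mixture]
  rw [integral_const_mul, integral_finsetSum _ fun s _ => hint s]
  simp only [hone, Finset.sum_const, nsmul_eq_mul, mul_one]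
  exact inv_mul_cancel₀ (by positivity)

/-- The integrand lies between `p s - mixture S p` (from `log x ≥ 1 - 1/x`) and `p s * log S.card`,
both integrable. -/
theorem integrable_mul_log_div_mixture (hp : ∀ s y, 0 < p s y) (hint : ∀ s, Integrable (p s) μ)
    {s : ι} (hs : s ∈ S) :
    Integrable (fun y => p s y * Real.log (p s y / mixture S p y)) μ := by
  have hS : S.Nonempty := ⟨s, hs⟩
  have hlow : Integrable (fun y => p s y - mixture S p y) μ :=
    (hint s).sub (integrable_mixture hint)
  have hup : Integrable (fun y => p s y * Real.log S.card) μ := (hint s).mul_const _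
  have hsm : AEStronglyMeasurable (fun y => p s y * Real.log (p s y / mixture S p y)) μ := by
    have h1 := (hint s).aestronglyMeasurable.aemeasurable
    have h2 := (integrable_mixture (S := S) hint).aestronglyMeasurable.aemeasurable
    exact (h1.mul (Real.measurable_log.comp_aemeasurable (h1.div h2))).aestronglyMeasurable
  refine integrable_of_le_of_le hsm (ae_of_all _ fun y => ?_) (ae_of_all _ fun y => ?_) hlow hup
  · have hq := mixture_pos hS hp y
    have h := Real.one_sub_inv_le_log_of_pos (div_pos (hp s y) hq)
    have h2 := mul_le_mul_of_nonneg_left h (hp s y).le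
    refine le_trans (le_of_eq ?_) h2
    have := (hp s y).ne'
    field_simp
  · exact mul_le_mul_of_nonneg_left (log_div_mixture_le hp hs y) (hp s y).le

/-- Mutual information, in nats, between a uniform input on `S` and the output with densities `p`. -/
noncomputable def uniformInfo (μ : Measure Y) (S : Finset ι) (p : ι → Y → ℝ) : ℝ :=
  (S.card : ℝ)⁻¹ * ∑ s ∈ S, ∫ y, p s y * Real.log (p s y / mixture S p y) ∂μ

theorem uniformInfo_le_log_card (hS : S.Nonempty) (hp : ∀ s y, 0 < p s y)
    (hint : ∀ s, Integrable (p s) μ) (hone : ∀ s, ∫ y, p s y ∂μ = 1) :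
    uniformInfo μ S p ≤ Real.log S.card := by
  have hc := hS.card_pos
  rw [uniformInfo, inv_mul_le_iff₀ (by positivity), ← nsmul_eq_mul]
  refine Finset.sum_le_card_nsmul _ _ _ fun s hs => ?_
  calc _ ≤ ∫ y, p s y * Real.log S.card ∂μ :=
        integral_mono (integrable_mul_log_div_mixture hp hint hs) ((hint s).mul_const _) fun y =>
          mul_le_mul_of_nonneg_left (log_div_mixture_le hp hs y) (hp s y).le
    _ = Real.log S.card := by rw [integral_mul_const, hone, one_mul]

/-- The mutual information is at least the cutoff rate. -/
theorem neg_log_le_uniformInfo (hS : S.Nonempty) (hp : ∀ s y, 0 < p s y)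
    (hint : ∀ s, Integrable (p s) μ) (hone : ∀ s, ∫ y, p s y ∂μ = 1)
    (hsq : ∀ s s', Integrable (fun y => √(p s y) * √(p s' y)) μ)
    {b : ℝ} (hb : 0 < b)
    (hle : ∑ s ∈ S, ∑ s' ∈ S, ∫ y, √(p s y) * √(p s' y) ∂μ ≤ S.card ^ 2 * b) :
    -Real.log b ≤ uniformInfo μ S p := by
  have hc : (0 : ℝ) < S.card := by exact_mod_cast hS.card_pos
  set q := mixture S p with hq
  set r : Y → ℝ := mixture S fun s y => √(p s y) with hr
  have hsp : ∀ s y, 0 < √(p s y) := fun s y => Real.sqrt_pos.2 (hp s y)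
  have hqpos := mixture_pos (p := p) hS hp
  have hrpos : ∀ y, 0 < r y := mixture_pos hS hsp
  have hrr : ∀ y, r y ^ 2 = (S.card : ℝ)⁻¹ ^ 2 * ∑ s ∈ S, ∑ s' ∈ S, √(p s y) * √(p s' y) := by
    intro y
    rw [hr, mixture, mul_pow, sq (∑ s ∈ S, √(p s y)), Finset.sum_mul_sum]
  have hrint : Integrable (fun y => r y ^ 2) μ := by
    simp only [hrr]
    exact (integrable_finsetSum _ fun s _ => integrable_finsetSum _ fun s' _ => hsq s s').const_mul _
  have hrle : ∫ y, r y ^ 2 ∂μ ≤ b := by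
    simp only [hrr]
    rw [integral_const_mul, integral_finsetSum _ fun s _ =>
      integrable_finsetSum _ fun s' _ => hsq s s']
    simp only [integral_finsetSum _ fun s' _ => hsq _ s']
    calc _ ≤ (S.card : ℝ)⁻¹ ^ 2 * (S.card ^ 2 * b) := by gcongr
      _ = b := by field_simp
  -- With `r` the mean of the `√p`, split `log (p/q) = log (√p r / q) + log (b √p / r) - log b` and
  -- apply `log x ≥ 1 - 1/x` to both terms. After multiplication by `p` and summation over `s`, the
  -- error terms become multiples of `q` and `r²`, whose integrals are `1` and at most `b`; this
  -- replaces Jensen's inequality.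
  have key : ∀ y, (2 - Real.log b) * (S.card * q y) - S.card * q y - b⁻¹ * (S.card * r y ^ 2) ≤
      ∑ s ∈ S, p s y * Real.log (p s y / q y) := by
    intro y
    have hpt : ∀ s ∈ S, (2 - Real.log b) * p s y - √(p s y) * (q y / r y) - b⁻¹ * (√(p s y) * r y) ≤
        p s y * Real.log (p s y / q y) := by
      intro s _
      have h1 := Real.one_sub_inv_le_log_of_pos
        (div_pos (mul_pos (hsp s y) (hrpos y)) (hqpos y))
      have h2 := Real.one_sub_inv_le_log_of_pos
        (div_pos (mul_pos hb (hsp s y)) (hrpos y))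
      have h3 : Real.log (p s y / q y) = Real.log (√(p s y) * r y / q y) +
          Real.log (b * √(p s y) / r y) - Real.log b := by
        have hsq' := Real.mul_self_sqrt (hp s y).le
        rw [← Real.log_mul (div_pos (mul_pos (hsp s y) (hrpos y)) (hqpos y)).ne'
          (div_pos (mul_pos hb (hsp s y)) (hrpos y)).ne',
          ← Real.log_div (mul_pos (div_pos (mul_pos (hsp s y) (hrpos y)) (hqpos y))
          (div_pos (mul_pos hb (hsp s y)) (hrpos y))).ne' hb.ne']
        congr 1
        have := (hrpos y).ne'
        have := (hqpos y).ne'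
        rw [hq] at *
        field_simp
        rw [Real.sq_sqrt (hp s y).le]
      have h4 : (2 - Real.log b) - (√(p s y) * r y / q y)⁻¹ - (b * √(p s y) / r y)⁻¹ ≤
          Real.log (p s y / q y) := by linarith
      refine le_trans (le_of_eq ?_) (mul_le_mul_of_nonneg_left h4 (hp s y).le)
      have e1 : p s y * (√(p s y) * r y / q y)⁻¹ = √(p s y) * (q y / r y) := by
        nth_rewrite 1 [← Real.mul_self_sqrt (hp s y).le]
        have := (hsp s y).ne'
        have := (hrpos y).ne'
        field_simp
      have e2 : p s y * (b * √(p s y) / r y)⁻¹ = b⁻¹ * (√(p s y) * r y) := by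
        nth_rewrite 1 [← Real.mul_self_sqrt (hp s y).le]
        have := (hsp s y).ne'
        have := (hrpos y).ne'
        field_simp
      rw [mul_sub, mul_sub, e1, e2, mul_comm (p s y)]
    refine le_trans (le_of_eq ?_) (Finset.sum_le_sum hpt)
    rw [Finset.sum_sub_distrib, Finset.sum_sub_distrib, ← Finset.mul_sum, ← Finset.mul_sum,
      ← Finset.sum_mul, ← Finset.sum_mul, sum_eq_card_mul_mixture hS,
      sum_eq_card_mul_mixture (p := fun s y => √(p s y)) hS]
    have := (hrpos y).ne'
    rw [← hr, ← hq]
    field_simp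
  have hqint : Integrable q μ := integrable_mixture hint
  have hq1 : ∫ y, q y ∂μ = 1 := integral_mixture hS hint hone
  have hI := integral_mono
    (((hqint.const_mul (S.card : ℝ)).const_mul (2 - Real.log b)).sub (hqint.const_mul (S.card : ℝ))
      |>.sub ((hrint.const_mul (S.card : ℝ)).const_mul b⁻¹))
    (integrable_finsetSum S fun s hs => integrable_mul_log_div_mixture hp hint hs) key
  rw [integral_finsetSum S fun s hs => integrable_mul_log_div_mixture hp hint hs] at hI
  rw [integral_sub' (((hqint.const_mul (S.card : ℝ)).const_mul (2 - Real.log b)).sub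
    (hqint.const_mul (S.card : ℝ))) ((hrint.const_mul (S.card : ℝ)).const_mul b⁻¹),
    integral_sub' ((hqint.const_mul (S.card : ℝ)).const_mul (2 - Real.log b))
    (hqint.const_mul (S.card : ℝ)), integral_const_mul, integral_const_mul, integral_const_mul,
    integral_const_mul, hq1] at hI
  rw [uniformInfo, inv_mul_eq_div, le_div_iff₀ hc]
  refine le_trans ?_ hI
  have : b⁻¹ * (S.card * ∫ y, r y ^ 2 ∂μ) ≤ S.card := by
    calc _ ≤ b⁻¹ * (S.card * b) := by gcongr
      _ = S.card := by field_simp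
  linarith

/-- An upper bound on the mutual information by the mean `χ²` divergence of pairs of inputs. -/
theorem uniformInfo_le_of_sq_div (hS : S.Nonempty) (hp : ∀ s y, 0 < p s y)
    (hint : ∀ s, Integrable (p s) μ) (hone : ∀ s, ∫ y, p s y ∂μ = 1)
    (hchi : ∀ s s', Integrable (fun y => p s y ^ 2 / p s' y) μ)
    {b : ℝ} (hle : ∀ s ∈ S, ∀ s' ∈ S, ∫ y, p s y ^ 2 / p s' y ∂μ ≤ 1 + b) :
    uniformInfo μ S p ≤ b := by
  have hc : (0 : ℝ) < S.card := by exact_mod_cast hS.card_pos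
  rw [uniformInfo, inv_mul_le_iff₀ hc, ← nsmul_eq_mul]
  refine Finset.sum_le_card_nsmul _ _ _ fun s hs => ?_
  have key : ∀ y, p s y * Real.log (p s y / mixture S p y) ≤
      (S.card : ℝ)⁻¹ * ∑ s' ∈ S, p s y ^ 2 / p s' y - p s y := by
    intro y
    have hq := mixture_pos hS hp y
    have h1 := mul_le_mul_of_nonneg_left
      (Real.log_le_sub_one_of_pos (div_pos (hp s y) hq)) (hp s y).le
    -- Harmonic mean against arithmetic mean, by Cauchy–Schwarz. It replaces the mixture by single
    -- densities, for which the integrals are explicit.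
    have h2 : (mixture S p y)⁻¹ ≤ (S.card : ℝ)⁻¹ * ∑ s' ∈ S, (p s' y)⁻¹ := by
      have hcs := Finset.sum_sq_le_sum_mul_sum_of_sq_le_mul S (r := fun _ => (1 : ℝ))
        (f := fun s' => p s' y) (g := fun s' => (p s' y)⁻¹) (fun i _ => (hp i y).le)
        (fun i _ => (inv_pos.2 (hp i y)).le) (fun i _ => by
          rw [mul_inv_cancel₀ (hp i y).ne', one_pow])
      rw [Finset.sum_const, nsmul_eq_mul, mul_one, sum_eq_card_mul_mixture hS] at hcs
      rw [inv_eq_one_div, div_le_iff₀ hq, mul_comm, ← mul_assoc, ← div_eq_mul_inv, mul_comm]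
      rw [← mul_le_mul_iff_of_pos_left (pow_pos hc 2)]
      refine le_trans (by linarith) (hcs.trans (le_of_eq ?_))
      field_simp
    calc _ ≤ p s y ^ 2 * (mixture S p y)⁻¹ - p s y := by
          refine h1.trans (le_of_eq ?_); ring
      _ ≤ p s y ^ 2 * ((S.card : ℝ)⁻¹ * ∑ s' ∈ S, (p s' y)⁻¹) - p s y := by gcongr
      _ = _ := by
        rw [mul_left_comm, Finset.mul_sum]
        simp only [div_eq_mul_inv]
  have hsum : Integrable (fun y => ∑ s' ∈ S, p s y ^ 2 / p s' y) μ :=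
    integrable_finsetSum S fun s' _ => hchi s s'
  refine (integral_mono (integrable_mul_log_div_mixture hp hint hs)
    ((hsum.const_mul _).sub (hint s)) key).trans ?_
  rw [integral_sub' (hsum.const_mul _) (hint s), integral_const_mul,
    integral_finsetSum S fun s' _ => hchi s s', hone]
  have := Finset.sum_le_card_nsmul S _ _ fun s' hs' => hle s hs s' hs'
  rw [nsmul_eq_mul] at this
  rw [sub_le_iff_le_add, inv_mul_le_iff₀ hc]
  linarith

end UniformInput

/-! ### The Gaussian noise density -/

/-- The density at `y` of `z + w`, where `w` has i.i.d. `CN(0, 1)` components. -/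
noncomputable def noiseDensity {N : ℕ} (z y : Fin N → ℂ) : ℝ := (Real.pi⁻¹) ^ N * likelihood y z

theorem noiseDensity_pos {N : ℕ} (z y : Fin N → ℂ) : 0 < noiseDensity z y := by
  unfold noiseDensity likelihood; positivity

theorem continuous_noiseDensity {N : ℕ} (z : Fin N → ℂ) : Continuous (noiseDensity z) := by
  unfold noiseDensity likelihood; fun_prop

theorem complexGaussian_one :
    complexGaussian 1 = volume.withDensity fun z => ENNReal.ofReal (Real.pi⁻¹ * Real.exp (-‖z‖ ^ 2)) := by
  have hone : (1 / 2 : ℝ≥0) ≠ 0 := by norm_num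
  ext s hs
  rw [complexGaussian, MeasurableEquiv.map_apply, gaussianReal_of_var_ne_zero _ hone,
    prod_withDensity (measurable_gaussianPDF _ _) (measurable_gaussianPDF _ _),
    withDensity_apply _ (MeasurableEquiv.measurable _ hs), withDensity_apply _ hs,
    ← (Complex.volume_preserving_equiv_real_prod.symm).setLIntegral_comp_preimage_emb
      (MeasurableEquiv.measurableEmbedding _)]
  refine setLIntegral_congr_fun (MeasurableEquiv.measurable _ hs) fun x _ => ?_
  simp only [gaussianPDF_def]
  rw [← ENNReal.ofReal_mul (gaussianPDFReal_nonneg _ _ _)]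
  congr 1
  rw [gaussianPDFReal_def]
  have e : ‖Complex.measurableEquivRealProd.symm x‖ ^ 2 = x.1 ^ 2 + x.2 ^ 2 := by
    rw [norm_sq_eq_re_im]; rfl
  have h2 : 2 * Real.pi * ((1 / 2 : ℝ≥0) : ℝ) = Real.pi := by push_cast; ring
  have h3 : 2 * ((1 / 2 : ℝ≥0) : ℝ) = 1 := by push_cast; ring
  simp only [h2, h3, sub_zero, div_one, e]
  rw [mul_mul_mul_comm, ← mul_inv, Real.mul_self_sqrt Real.pi_pos.le, ← Real.exp_add]
  congr 2; ring

theorem pi_complexGaussian_one (N : ℕ) :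
    (Measure.pi fun _ : Fin N => complexGaussian 1) =
      volume.withDensity fun w => ENNReal.ofReal (noiseDensity 0 w) := by
  set f : ℂ → ℝ := fun z => Real.pi⁻¹ * Real.exp (-‖z‖ ^ 2) with hf
  have hf0 : ∀ z, 0 ≤ f z := fun z => by rw [hf]; positivity
  have hfm : Measurable f := by rw [hf]; fun_prop
  have hfint : Integrable f := by
    refine ⟨hfm.aestronglyMeasurable, ?_⟩
    rw [hasFiniteIntegral_iff_ofReal (ae_of_all _ hf0)]
    have : complexGaussian 1 Set.univ = ∫⁻ z, ENNReal.ofReal (f z) := by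
      rw [complexGaussian_one, withDensity_apply _ .univ, Measure.restrict_univ]
    rw [← this, measure_univ]
    exact ENNReal.one_lt_top
  refine Measure.pi_eq fun s hs => ?_
  have hprod : ∀ w : Fin N → ℂ, noiseDensity 0 w = ∏ j, f (w j) := fun w => by
    simp only [noiseDensity, likelihood, hf, Finset.prod_mul_distrib, Finset.prod_const,
      Finset.card_univ, Fintype.card_fin, ← Real.exp_sum, Finset.sum_neg_distrib, Pi.zero_apply,
      sub_zero]
  rw [withDensity_apply _ (MeasurableSet.univ_pi hs), volume_pi, Measure.restrict_pi_pi]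
  simp only [hprod]
  rw [← ofReal_integral_eq_lintegral_ofReal, integral_fintype_prod_eq_prod (fun _ => f),
    ENNReal.ofReal_prod_of_nonneg (fun _ _ => integral_nonneg hf0)]
  · refine Finset.prod_congr rfl fun j _ => ?_
    rw [complexGaussian_one, withDensity_apply _ (hs j),
      ofReal_integral_eq_lintegral_ofReal hfint.integrableOn (ae_of_all _ hf0)]
  · exact Integrable.fintype_prod fun j => hfint.integrableOn
  · exact ae_of_all _ fun w => Finset.prod_nonneg fun j _ => hf0 _

theorem noiseDensity_eq_sub {N : ℕ} (z y : Fin N → ℂ) : noiseDensity z y = noiseDensity 0 (y - z) := by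
  simp [noiseDensity, likelihood]

/-- Translation invariance of Lebesgue measure turns an average over the noise into an integral
against the output density, the form that `uniformInfo` requires. -/
theorem integral_pi_complexGaussian_add {N : ℕ} (z : Fin N → ℂ) (F : (Fin N → ℂ) → ℝ) :
    ∫ w, F (z + w) ∂(Measure.pi fun _ : Fin N => complexGaussian 1) =
      ∫ y, noiseDensity z y * F y := by
  rw [pi_complexGaussian_one, integral_withDensity_eq_integral_toReal_smul
    (continuous_noiseDensity 0).measurable.ennreal_ofReal (ae_of_all _ fun _ => ENNReal.ofReal_lt_top)]
  rw [← integral_add_right_eq_self (fun y => noiseDensity z y * F y) z]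
  refine integral_congr_ae (ae_of_all _ fun w => ?_)
  simp only [ENNReal.toReal_ofReal (noiseDensity_pos 0 w).le, smul_eq_mul]
  rw [noiseDensity_eq_sub z, add_sub_cancel_right, add_comm z]

theorem integral_noiseDensity {N : ℕ} (z : Fin N → ℂ) : ∫ y, noiseDensity z y = 1 := by
  have := integral_pi_complexGaussian_add z fun _ => 1
  simpa using this.symm

theorem integrable_noiseDensity {N : ℕ} (z : Fin N → ℂ) : Integrable (noiseDensity z) := by
  -- A non-integrable function would have Bochner integral `0`, not `1`.
  by_contra h
  have := integral_noiseDensity z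
  rw [integral_undef h] at this
  exact zero_ne_one this

/-- Completing the square at the midpoint of `z` and `z'`; hence the Bhattacharyya coefficient is
`exp (-‖z - z'‖² / 4)`. -/
theorem sqrt_noiseDensity_mul {N : ℕ} (z z' y : Fin N → ℂ) :
    √(noiseDensity z y) * √(noiseDensity z' y) =
      Real.exp (-(∑ j, ‖z j - z' j‖ ^ 2) / 4) * noiseDensity (fun j => (z j + z' j) / 2) y := by
  rw [← Real.sqrt_mul (noiseDensity_pos _ _).le]
  refine Real.sqrt_eq_iff_mul_self_eq_of_pos
    (mul_pos (Real.exp_pos _) (noiseDensity_pos _ _)) |>.2 ?_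
  simp only [noiseDensity, likelihood]
  have : -(∑ j, ‖z j - z' j‖ ^ 2) / 4 + (-∑ j, ‖y j - (z j + z' j) / 2‖ ^ 2) +
      (-(∑ j, ‖z j - z' j‖ ^ 2) / 4 + (-∑ j, ‖y j - (z j + z' j) / 2‖ ^ 2)) =
      (-∑ j, ‖y j - z j‖ ^ 2) + (-∑ j, ‖y j - z' j‖ ^ 2) := by
    simp only [← Finset.sum_neg_distrib, Finset.sum_div, ← Finset.sum_add_distrib]
    refine Finset.sum_congr rfl fun j _ => ?_
    simp only [norm_sq_eq_re_im, Complex.sub_re, Complex.sub_im, Complex.div_ofNat_re,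
      Complex.div_ofNat_im, Complex.add_re, Complex.add_im]
    ring
  calc _ = (Real.pi⁻¹ ^ N) * (Real.pi⁻¹ ^ N) * Real.exp (-(∑ j, ‖z j - z' j‖ ^ 2) / 4 +
        (-∑ j, ‖y j - (z j + z' j) / 2‖ ^ 2) +
      (-(∑ j, ‖z j - z' j‖ ^ 2) / 4 + (-∑ j, ‖y j - (z j + z' j) / 2‖ ^ 2))) := by
        simp only [Real.exp_add]; ring
    _ = _ := by rw [this, Real.exp_add]; ring

/-- Completing the square at the reflected point `2 z - z'`; hence the `χ²` integral is `exp (2 ‖z -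
z'‖²)`. -/
theorem noiseDensity_sq_div {N : ℕ} (z z' y : Fin N → ℂ) :
    noiseDensity z y ^ 2 / noiseDensity z' y =
      Real.exp (2 * ∑ j, ‖z j - z' j‖ ^ 2) * noiseDensity (fun j => 2 * z j - z' j) y := by
  rw [div_eq_iff (noiseDensity_pos _ _).ne', sq]
  simp only [noiseDensity, likelihood]
  have : (2 * ∑ j, ‖z j - z' j‖ ^ 2) + (-∑ j, ‖y j - (2 * z j - z' j)‖ ^ 2) +
      (-∑ j, ‖y j - z' j‖ ^ 2) = (-∑ j, ‖y j - z j‖ ^ 2) + (-∑ j, ‖y j - z j‖ ^ 2) := by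
    simp only [← Finset.sum_neg_distrib, Finset.mul_sum, ← Finset.sum_add_distrib]
    refine Finset.sum_congr rfl fun j _ => ?_
    simp only [norm_sq_eq_re_im, Complex.sub_re, Complex.sub_im, Complex.mul_re, Complex.mul_im,
      Complex.re_ofNat, Complex.im_ofNat]
    ring
  calc _ = (Real.pi⁻¹ ^ N) * (Real.pi⁻¹ ^ N) * Real.exp ((-∑ j, ‖y j - z j‖ ^ 2) +
        (-∑ j, ‖y j - z j‖ ^ 2)) := by rw [Real.exp_add]; ring
    _ = _ := by rw [← this, Real.exp_add, Real.exp_add]; ring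

/-! ### Bounds on the mutual information of a group of sub-channels -/

variable {N : ℕ} {X : Finset ℂ} {U : Matrix (Fin N) (Fin N) ℂ} {a : Fin N → ℝ}

/-- The normalization `π ^ (-N)` cancels in the likelihood ratio, and `log 2` converts nats to bits.
-/
theorem groupInfo_eq (X : Finset ℂ) (U : Matrix (Fin N) (Fin N) ℂ) (a : Fin N → ℝ) :
    groupInfo X U a = uniformInfo volume (Fintype.piFinset fun _ : Fin N => X)
      (fun s => noiseDensity (received U a s)) / Real.log 2 := by
  have hcard : ((Fintype.piFinset fun _ : Fin N => X).card : ℝ) = (X.card : ℝ) ^ N := by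
    rw [Fintype.card_piFinset_const]; push_cast; rfl
  rw [groupInfo, uniformInfo, mul_div_assoc, Finset.sum_div, hcard]
  congr 1
  refine Finset.sum_congr rfl fun s _ => ?_
  rw [integral_pi_complexGaussian_add (received U a s) fun y => Real.logb 2
    (likelihood y (received U a s) / (((X.card : ℝ) ^ N)⁻¹ *
      ∑ s' ∈ Fintype.piFinset (fun _ : Fin N => X), likelihood y (received U a s'))),
    ← integral_div]
  refine integral_congr_ae (ae_of_all _ fun y => ?_)
  simp only [mixture, hcard, Real.logb, noiseDensity, ← Finset.mul_sum]
  rw [mul_div_assoc]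
  congr 3
  rw [mul_left_comm ((X.card : ℝ) ^ N)⁻¹, mul_div_mul_left _ _ (by positivity)]

theorem sum_norm_received_sub_sq (ha : ∀ j, 0 ≤ a j) (s s' : Fin N → ℂ) :
    ∑ j, ‖received U a s j - received U a s' j‖ ^ 2 =
      ∑ j, a j * ‖(U.mulVec (s - s')) j‖ ^ 2 := by
  refine Finset.sum_congr rfl fun j _ => ?_
  rw [received, received, ← mul_sub, norm_mul, mul_pow, Matrix.mulVec_sub, Pi.sub_apply,
    Complex.norm_real, Real.norm_eq_abs, sq_abs, Real.sq_sqrt (ha j)]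

theorem groupInfo_le_log_card (hX : X.Nonempty) :
    groupInfo X U a ≤ N * Real.logb 2 X.card := by
  rw [groupInfo_eq, Real.logb, ← mul_div_assoc]
  refine div_le_div_of_nonneg_right ?_ (Real.log_nonneg one_le_two)
  refine (uniformInfo_le_log_card (Fintype.piFinset_nonempty.2 fun _ => hX)
    (fun s => noiseDensity_pos _) (fun s => integrable_noiseDensity _)
    fun s => integral_noiseDensity _).trans (le_of_eq ?_)
  rw [Fintype.card_piFinset_const, Nat.cast_pow, Real.log_pow]

theorem groupInfo_le_of_small (hX : X.Nonempty) (ha : ∀ j, 0 ≤ a j) {b : ℝ} (hb : 0 ≤ b)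
    (h : ∀ s ∈ Fintype.piFinset (fun _ : Fin N => X), ∀ s' ∈ Fintype.piFinset (fun _ : Fin N => X),
      2 * ∑ j, a j * ‖(U.mulVec (s - s')) j‖ ^ 2 ≤ Real.log (1 + b)) :
    groupInfo X U a ≤ b / Real.log 2 := by
  rw [groupInfo_eq]
  refine div_le_div_of_nonneg_right ?_ (Real.log_nonneg one_le_two)
  refine uniformInfo_le_of_sq_div (Fintype.piFinset_nonempty.2 fun _ => hX)
    (fun s => noiseDensity_pos _) (fun s => integrable_noiseDensity _)
    (fun s => integral_noiseDensity _) (fun s s' => ?_) (fun s hs s' hs' => ?_)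
  · simp only [noiseDensity_sq_div]
    exact (integrable_noiseDensity _).const_mul _
  · simp only [noiseDensity_sq_div]
    rw [integral_const_mul, integral_noiseDensity, mul_one, sum_norm_received_sub_sq ha]
    exact (Real.le_log_iff_exp_le (by linarith)).1 (h s hs s' hs')

/-- The cutoff-rate bound: if all pairs of distinct symbol vectors are at squared distance at
least `4 t`, then the mutual information is at least
`- log₂ ((1 - exp (-t)) / n + exp (-t))`, where `n` is the number of symbol vectors. -/
theorem le_groupInfo_of_separated (hX : X.Nonempty) (ha : ∀ j, 0 ≤ a j) {t : ℝ}
    (h : ∀ s ∈ Fintype.piFinset (fun _ : Fin N => X), ∀ s' ∈ Fintype.piFinset (fun _ : Fin N => X),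
      s ≠ s' → 4 * t ≤ ∑ j, a j * ‖(U.mulVec (s - s')) j‖ ^ 2) :
    -Real.logb 2 (((X.card : ℝ) ^ N)⁻¹ + (1 - ((X.card : ℝ) ^ N)⁻¹) * Real.exp (-t)) ≤
      groupInfo X U a := by
  classical
  set S := Fintype.piFinset fun _ : Fin N => X with hS
  have hSne : S.Nonempty := Fintype.piFinset_nonempty.2 fun _ => hX
  have hcard : (S.card : ℝ) = (X.card : ℝ) ^ N := by
    rw [hS, Fintype.card_piFinset_const]; push_cast; rfl
  have hc : (1 : ℝ) ≤ S.card := by exact_mod_cast hSne.card_pos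
  rw [groupInfo_eq, Real.logb, ← neg_div, ← hcard]
  have hinv : (S.card : ℝ)⁻¹ ≤ 1 := inv_le_one_of_one_le₀ hc
  refine div_le_div_of_nonneg_right ?_ (Real.log_nonneg one_le_two)
  refine neg_log_le_uniformInfo hSne
    (fun s => noiseDensity_pos _) (fun s => integrable_noiseDensity _)
    (fun s => integral_noiseDensity _) (fun s s' => ?_) ?_ ?_
  · simp only [sqrt_noiseDensity_mul]
    exact (integrable_noiseDensity _).const_mul _
  · have : 0 < (S.card : ℝ)⁻¹ := by positivity
    have : 0 ≤ 1 - (S.card : ℝ)⁻¹ := by linarith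
    positivity
  · simp only [sqrt_noiseDensity_mul, integral_const_mul, integral_noiseDensity, mul_one,
      sum_norm_received_sub_sq ha]
    have hrow : ∀ s ∈ S, ∑ s' ∈ S,
        Real.exp (-(∑ j, a j * ‖(U.mulVec (s - s')) j‖ ^ 2) / 4) ≤
          1 + (S.card - 1) * Real.exp (-t) := by
      intro s hs
      rw [← Finset.add_sum_erase S _ hs]
      refine add_le_add (by simp) ?_
      refine (Finset.sum_le_card_nsmul _ _ (Real.exp (-t)) fun s' hs' => ?_).trans (le_of_eq ?_)
      · have := h s hs s' (Finset.mem_of_mem_erase hs') (Finset.ne_of_mem_erase hs').symm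
        exact Real.exp_le_exp.2 (by linarith)
      · rw [Finset.card_erase_of_mem hs, nsmul_eq_mul, Nat.cast_pred hSne.card_pos]
    refine (Finset.sum_le_card_nsmul _ _ _ hrow).trans (le_of_eq ?_)
    rw [nsmul_eq_mul]
    field_simp

/-! ### Full diversity: no outage when enough groups have a strong sub-channel -/

theorem eventually_exp_neg_rpow_le {b δ C : ℝ} (hb : 0 < b) (hδ : 0 < δ) (hC : 0 < C) (Q : ℝ) :
    ∀ᶠ ρ : ℝ in atTop, Real.exp (-(b * ρ ^ δ)) ≤ C * ρ ^ (-Q) := by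
  have h := (isLittleO_exp_neg_mul_rpow_atTop hb (-Q / δ)).def hC
  filter_upwards [(tendsto_rpow_atTop hδ).eventually h, eventually_gt_atTop 0] with ρ h1 h2
  rw [Real.norm_of_nonneg (Real.exp_pos _).le, Real.norm_of_nonneg (by positivity),
    ← Real.rpow_mul h2.le, mul_div_cancel₀ _ hδ.ne', neg_mul] at h1
  exact h1

/-- Full diversity becomes quantitative because there are only finitely many pairs of symbol vectors
and components. -/
theorem exists_forall_le_norm_mulVec_sq {K N : ℕ} {X : Finset ℂ}
    {U : Fin K → Matrix (Fin N) (Fin N) ℂ} (hdiv : ∀ k, IsFullDiversity X (U k)) :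
    ∃ l : ℝ, 0 < l ∧ ∀ k, ∀ s ∈ Fintype.piFinset (fun _ : Fin N => X),
      ∀ s' ∈ Fintype.piFinset (fun _ : Fin N => X), s ≠ s' →
        ∀ j, l ≤ ‖((U k).mulVec (s - s')) j‖ ^ 2 := by
  classical
  set S := Fintype.piFinset fun _ : Fin N => X
  set T := (Finset.univ : Finset (Fin K × Fin N)) ×ˢ S.offDiag
  have hT : ∀ p ∈ T, 0 < ‖((U p.1.1).mulVec (p.2.1 - p.2.2)) p.1.2‖ ^ 2 := by
    intro p hp
    obtain ⟨h1, h2, h3⟩ := Finset.mem_offDiag.1 (Finset.mem_product.1 hp).2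
    have := hdiv p.1.1 _ _ (Fintype.mem_piFinset.1 h1) (Fintype.mem_piFinset.1 h2) h3 p.1.2
    positivity
  rcases T.eq_empty_or_nonempty with hE | hne
  · refine ⟨1, one_pos, fun k s hs s' hs' hss j => ?_⟩
    have : ((k, j), (s, s')) ∈ T := by simp [T, hs, hs', hss]
    simp [hE] at this
  · obtain ⟨p, hp, hmin⟩ := T.exists_min_image
      (fun p => ‖((U p.1.1).mulVec (p.2.1 - p.2.2)) p.1.2‖ ^ 2) hne
    exact ⟨_, hT p hp, fun k s hs s' hs' hss j => hmin ((k, j), (s, s')) (by simp [T, hs, hs', hss])⟩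

section Group

variable {N : ℕ} {X : Finset ℂ} {U : Matrix (Fin N) (Fin N) ℂ} {a : Fin N → ℝ} {l : ℝ}

theorem separated_of_le {j : Fin N} (ha : ∀ j, 0 ≤ a j)
    (hl : ∀ s ∈ Fintype.piFinset (fun _ : Fin N => X),
      ∀ s' ∈ Fintype.piFinset (fun _ : Fin N => X), s ≠ s' →
        ∀ j, l ≤ ‖(U.mulVec (s - s')) j‖ ^ 2) {x : ℝ} (hl0 : 0 ≤ l) (hx : x ≤ a j) :
    ∀ s ∈ Fintype.piFinset (fun _ : Fin N => X), ∀ s' ∈ Fintype.piFinset (fun _ : Fin N => X),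
      s ≠ s' → 4 * (l / 4 * x) ≤ ∑ j, a j * ‖(U.mulVec (s - s')) j‖ ^ 2 := by
  intro s hs s' hs' hss
  calc 4 * (l / 4 * x) = l * x := by ring
    _ ≤ l * a j := by gcongr
    _ ≤ a j * ‖(U.mulVec (s - s')) j‖ ^ 2 := by
        rw [mul_comm]; exact mul_le_mul_of_nonneg_left (hl s hs s' hs' hss j) (ha j)
    _ ≤ _ := Finset.single_le_sum (f := fun j => a j * ‖(U.mulVec (s - s')) j‖ ^ 2)
        (fun i _ => mul_nonneg (ha i) (by positivity)) (Finset.mem_univ j)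

/-- A group with one strong sub-channel has nearly full mutual information. -/
theorem le_groupInfo_of_strong (hX : X.Nonempty) (ha : ∀ j, 0 ≤ a j) {t : ℝ}
    (h : ∀ s ∈ Fintype.piFinset (fun _ : Fin N => X), ∀ s' ∈ Fintype.piFinset (fun _ : Fin N => X),
      s ≠ s' → 4 * t ≤ ∑ j, a j * ‖(U.mulVec (s - s')) j‖ ^ 2) :
    N * Real.logb 2 X.card - (X.card : ℝ) ^ N * Real.exp (-t) / Real.log 2 ≤ groupInfo X U a := by
  refine le_trans ?_ (le_groupInfo_of_separated hX ha h)
  have hc : (0 : ℝ) < (X.card : ℝ) ^ N := by have := hX.card_pos; positivity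
  set n : ℝ := (X.card : ℝ) ^ N
  have hlog : Real.log (n⁻¹ + (1 - n⁻¹) * Real.exp (-t)) ≤ -Real.log n + n * Real.exp (-t) := by
    have hle : n⁻¹ + (1 - n⁻¹) * Real.exp (-t) ≤ n⁻¹ * (1 + n * Real.exp (-t)) := by
      rw [mul_add, inv_mul_cancel_left₀ hc.ne', mul_one]
      have := mul_pos (inv_pos.2 hc) (Real.exp_pos (-t))
      linarith
    have hpos : 0 < n⁻¹ + (1 - n⁻¹) * Real.exp (-t) := by
      have h1 : (1 : ℝ) ≤ n := one_le_pow₀ (by exact_mod_cast hX.card_pos)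
      have h2 : n⁻¹ ≤ 1 := inv_le_one_of_one_le₀ h1
      have h3 : 0 ≤ 1 - n⁻¹ := by linarith
      have := inv_pos.2 hc
      positivity
    refine (Real.log_le_log hpos hle).trans ?_
    rw [Real.log_mul (by positivity) (by positivity), Real.log_inv]
    have := Real.log_le_sub_one_of_pos (show 0 < 1 + n * Real.exp (-t) by positivity)
    linarith
  have hN : N * Real.logb 2 X.card = Real.log n / Real.log 2 := by
    rw [Real.logb, Real.log_pow]; ring
  rw [hN, Real.logb, ← sub_div, ← neg_div]
  refine div_le_div_of_nonneg_right ?_ (Real.log_nonneg one_le_two)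
  linarith

/-- From `-log u ≥ 1 - u` in the cutoff bound. It gives an amount of information linear in `t` for
small `t`, needed to settle the boundary case `K R = c M`. -/
theorem le_groupInfo_of_weak (hX : X.Nonempty) (ha : ∀ j, 0 ≤ a j) {t : ℝ}
    (h : ∀ s ∈ Fintype.piFinset (fun _ : Fin N => X), ∀ s' ∈ Fintype.piFinset (fun _ : Fin N => X),
      s ≠ s' → 4 * t ≤ ∑ j, a j * ‖(U.mulVec (s - s')) j‖ ^ 2) :
    (1 - ((X.card : ℝ) ^ N)⁻¹) * (1 - Real.exp (-t)) / Real.log 2 ≤ groupInfo X U a := by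
  refine le_trans ?_ (le_groupInfo_of_separated hX ha h)
  have hc : (0 : ℝ) < (X.card : ℝ) ^ N := by have := hX.card_pos; positivity
  set n : ℝ := (X.card : ℝ) ^ N
  have h1 : (1 : ℝ) ≤ n := one_le_pow₀ (by exact_mod_cast hX.card_pos)
  have hpos : 0 < n⁻¹ + (1 - n⁻¹) * Real.exp (-t) := by
    have h2 : n⁻¹ ≤ 1 := inv_le_one_of_one_le₀ h1
    have h3 : 0 ≤ 1 - n⁻¹ := by linarith
    have := inv_pos.2 hc
    positivity
  have := Real.log_le_sub_one_of_pos hpos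
  rw [Real.logb, ← neg_div]
  refine div_le_div_of_nonneg_right ?_ (Real.log_nonneg one_le_two)
  linarith

end Group

/-- The hypothesis `hc` allows equality, so `c` strong groups alone may miss the rate. Their total
deficit is exponentially small in `ρ ^ δ`, whereas one weak group, with SNR at least `ρ ^ (-Q)`,
contributes a polynomial amount and covers it. If no group is weak, the gap `R < log₂ |X|` absorbs
the deficit. -/
theorem eventually_le_instInfo {K N : ℕ} (hK : 0 < K) (hN : 0 < N) {X : Finset ℂ}
    (hX : 1 < X.card) {U : Fin K → Matrix (Fin N) (Fin N) ℂ}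
    (hdiv : ∀ k, IsFullDiversity X (U k)) {R : ℝ} (hR : R < Real.logb 2 X.card) {c : ℕ}
    (hc : K * R ≤ c * Real.logb 2 X.card) {δ Q : ℝ} (hδ : 0 < δ) (hQ : 0 < Q) :
    ∀ᶠ ρ : ℝ in atTop, ∀ a : Fin K × Fin N → ℝ, (∀ i, ρ ^ (-Q) ≤ a i) →
      c ≤ (Finset.univ.filter fun k => ∃ j, ρ ^ δ ≤ a (k, j)).card → R ≤ instInfo X U a := by
  obtain ⟨l, hl0, hl⟩ := exists_forall_le_norm_mulVec_sq hdiv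
  have hXne : X.Nonempty := Finset.card_pos.1 (by omega)
  set n : ℝ := (X.card : ℝ) ^ N with hn
  have hn2 : 2 ≤ n := by
    have h2 : (2 : ℝ) ≤ X.card := by exact_mod_cast hX
    exact h2.trans (le_self_pow₀ (by linarith) hN.ne')
  have hK0 : (0 : ℝ) < K := by exact_mod_cast hK
  have hN0 : (0 : ℝ) < N := by exact_mod_cast hN
  have hlog2 : 0 < Real.log 2 := Real.log_pos one_lt_two
  set L := Real.logb 2 X.card
  have hl4 : 0 < l / 4 := by positivity
  have htend : Tendsto (fun ρ : ℝ => l / 4 * ρ ^ (-Q)) atTop (𝓝 0) := by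
    simpa using (tendsto_rpow_neg_atTop hQ).const_mul (l / 4)
  have hgap : 0 < (L - R) * N * Real.log 2 / n := by
    have : 0 < L - R := by linarith
    positivity
  filter_upwards [eventually_exp_neg_rpow_le hl4 hδ (C := l / 16 / (K * n)) (by positivity) Q,
    eventually_exp_neg_rpow_le hl4 hδ hgap 0, htend.eventually_le_const one_pos,
    eventually_gt_atTop 0] with ρ h1 h2 h3 hρ a ha hcard
  have hρQ : 0 < ρ ^ (-Q) := Real.rpow_pos_of_pos hρ _
  have ha0 : ∀ i, 0 ≤ a i := fun i => hρQ.le.trans (ha i)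
  set G := Finset.univ.filter fun k => ∃ j, ρ ^ δ ≤ a (k, j)
  set Δ := n * Real.exp (-(l / 4 * ρ ^ δ)) / Real.log 2 with hΔ
  set w := (1 - n⁻¹) * (1 - Real.exp (-(l / 4 * ρ ^ (-Q)))) / Real.log 2 with hw
  have hstrong : ∀ k ∈ G, N * L - Δ ≤ groupInfo X (U k) fun j => a (k, j) := by
    intro k hk
    obtain ⟨j, hj⟩ := (Finset.mem_filter.1 hk).2
    exact le_groupInfo_of_strong hXne (fun j => ha0 _)
      (separated_of_le (j := j) (fun j => ha0 _) (hl k) hl0.le hj)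
  have hweak : ∀ k, w ≤ groupInfo X (U k) fun j => a (k, j) := fun k =>
    le_groupInfo_of_weak hXne (fun j => ha0 _)
      (separated_of_le (j := ⟨0, hN⟩) (fun j => ha0 _) (hl k) hl0.le (ha _))
  have hwlow : l / 16 * ρ ^ (-Q) / Real.log 2 ≤ w := by
    refine div_le_div_of_nonneg_right ?_ hlog2.le
    set x := l / 4 * ρ ^ (-Q) with hx
    have hx0 : 0 < x := by positivity
    have hinv : (1 : ℝ) / 2 ≤ 1 - n⁻¹ := by
      have : n⁻¹ ≤ 2⁻¹ := inv_anti₀ two_pos hn2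
      linarith
    have hexp : x / 2 ≤ 1 - Real.exp (-x) := by
      have h5 : Real.exp (-x) ≤ (1 + x)⁻¹ := by
        rw [Real.exp_neg]
        exact inv_anti₀ (by linarith) (by linarith [Real.add_one_le_exp x])
      have h6 : (1 + x)⁻¹ ≤ 1 - x / 2 := by
        rw [inv_le_iff_one_le_mul₀ (by linarith)]
        nlinarith
      linarith
    calc l / 16 * ρ ^ (-Q) = 1 / 2 * (x / 2) := by rw [hx]; ring
      _ ≤ _ := by gcongr
  have hw0 : 0 ≤ w := le_trans (by positivity) hwlow
  have hΔ0 : 0 ≤ Δ := by positivity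
  have hwΔ : K * Δ ≤ w := by
    refine le_trans ?_ hwlow
    rw [hΔ, mul_div_assoc', ← mul_assoc]
    refine div_le_div_of_nonneg_right ?_ hlog2.le
    calc K * n * Real.exp (-(l / 4 * ρ ^ δ)) ≤ K * n * (l / 16 / (K * n) * ρ ^ (-Q)) := by gcongr
      _ = _ := by field_simp
  have hΔgap : Δ ≤ (L - R) * N := by
    rw [neg_zero, Real.rpow_zero, mul_one] at h2
    rw [hΔ, div_le_iff₀ hlog2]
    calc _ ≤ n * ((L - R) * N * Real.log 2 / n) := by gcongr
      _ = _ := by field_simp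
  have hsplit : ∑ k ∈ G, groupInfo X (U k) (fun j => a (k, j)) +
      ∑ k ∈ Gᶜ, groupInfo X (U k) (fun j => a (k, j)) =
      ∑ k, groupInfo X (U k) (fun j => a (k, j)) := Finset.sum_add_sum_compl _ _
  have hG : G.card * (N * L - Δ) ≤ ∑ k ∈ G, groupInfo X (U k) (fun j => a (k, j)) := by
    rw [← nsmul_eq_mul]
    exact Finset.card_nsmul_le_sum _ _ _ hstrong
  have hGK : (G.card : ℝ) ≤ K := by
    have := Finset.card_le_univ G
    rw [Fintype.card_fin] at this
    exact_mod_cast this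
  rw [instInfo, ← div_eq_inv_mul, le_div_iff₀ (by push_cast; positivity), ← hsplit]
  push_cast
  by_cases hu : Gᶜ = ∅
  · have hGu : G = Finset.univ := by rwa [Finset.compl_eq_empty_iff] at hu
    have hGc : (G.card : ℝ) = K := by rw [hGu, Finset.card_univ, Fintype.card_fin]
    rw [hu, Finset.sum_empty, add_zero]
    rw [hGc] at hG
    refine le_trans ?_ hG
    nlinarith
  · obtain ⟨k, hk⟩ := Finset.nonempty_iff_ne_empty.2 hu
    have hGc : w ≤ ∑ k ∈ Gᶜ, groupInfo X (U k) (fun j => a (k, j)) :=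
      (hweak k).trans (Finset.single_le_sum
        (f := fun k => groupInfo X (U k) (fun j => a (k, j)))
        (fun i _ => hw0.trans (hweak i)) hk)
    have hL0 : 0 ≤ L := Real.logb_nonneg one_lt_two (by exact_mod_cast hX.le)
    have hcG : (c : ℝ) ≤ G.card := by exact_mod_cast hcard
    have e1 : R * (K * N) ≤ G.card * (N * L) := by
      calc R * (K * N) = N * (K * R) := by ring
        _ ≤ N * (c * L) := by gcongr
        _ ≤ N * (G.card * L) := by gcongr
        _ = _ := by ring
    have e2 : G.card * Δ ≤ K * Δ := by gcongr
    nlinarith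

/-! ### Converse: a lower bound on the outage probability of every power rule -/

theorem exists_forall_instInfo_lt {K N : ℕ} (hN : 0 < N) {X : Finset ℂ} (hX : X.Nonempty)
    (U : Fin K → Matrix (Fin N) (Fin N) ℂ) {R : ℝ} {G : Finset (Fin K)} (hG : G.Nonempty)
    (hR : (K - G.card) * Real.logb 2 X.card < K * R) :
    ∃ κ : ℝ, 0 < κ ∧ ∀ a : Fin K × Fin N → ℝ, (∀ i, 0 ≤ a i) →
      (∀ i ∈ G ×ˢ (Finset.univ : Finset (Fin N)), a i ≤ κ) → instInfo X U a < R := by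
  have hK : 0 < K := Fin.pos_iff_nonempty.2 ⟨hG.choose⟩
  have hK0 : (0 : ℝ) < K := by exact_mod_cast hK
  have hN0 : (0 : ℝ) < N := by exact_mod_cast hN
  have hlog2 : 0 < Real.log 2 := Real.log_pos one_lt_two
  set S := Fintype.piFinset fun _ : Fin N => X
  set L := Real.logb 2 X.card
  set Λ : ℝ := ∑ k, ∑ s ∈ S, ∑ s' ∈ S, ∑ j, ‖((U k).mulVec (s - s')) j‖ ^ 2 with hΛ
  have hΛ0 : 0 ≤ Λ := by positivity
  have hΛle : ∀ k, ∀ s ∈ S, ∀ s' ∈ S, ∑ j, ‖((U k).mulVec (s - s')) j‖ ^ 2 ≤ Λ := by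
    intro k s hs s' hs'
    calc _ ≤ ∑ s' ∈ S, ∑ j, ‖((U k).mulVec (s - s')) j‖ ^ 2 :=
          Finset.single_le_sum (f := fun s' => ∑ j, ‖((U k).mulVec (s - s')) j‖ ^ 2)
            (fun _ _ => by positivity) hs'
      _ ≤ ∑ s ∈ S, ∑ s' ∈ S, ∑ j, ‖((U k).mulVec (s - s')) j‖ ^ 2 :=
          Finset.single_le_sum (f := fun s => ∑ s' ∈ S, ∑ j, ‖((U k).mulVec (s - s')) j‖ ^ 2)
            (fun _ _ => by positivity) hs
      _ ≤ Λ := Finset.single_le_sum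
            (f := fun k => ∑ s ∈ S, ∑ s' ∈ S, ∑ j, ‖((U k).mulVec (s - s')) j‖ ^ 2)
            (fun _ _ => by positivity) (Finset.mem_univ k)
  have hgap : 0 < K * R - (K - G.card) * L := by linarith
  -- With this `b`, the groups in `G`, at most `K` of them, together use at most half of the missing
  -- information.
  set b : ℝ := N * (K * R - (K - G.card) * L) / K * Real.log 2 / 2 with hb
  have hb0 : 0 < b := by positivity
  have hlogb : 0 < Real.log (1 + b) := Real.log_pos (by linarith)
  refine ⟨Real.log (1 + b) / (2 * (Λ + 1)), by positivity, fun a ha haκ => ?_⟩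
  have hin : ∀ k ∈ G, groupInfo X (U k) (fun j => a (k, j)) ≤ b / Real.log 2 := by
    intro k hk
    refine groupInfo_le_of_small hX (fun j => ha _) hb0.le fun s hs s' hs' => ?_
    calc 2 * ∑ j, a (k, j) * ‖((U k).mulVec (s - s')) j‖ ^ 2
        ≤ 2 * ∑ j, Real.log (1 + b) / (2 * (Λ + 1)) * ‖((U k).mulVec (s - s')) j‖ ^ 2 := by
          gcongr with j
          exact haκ (k, j) (by simp [hk])
      _ = Real.log (1 + b) / (Λ + 1) * ∑ j, ‖((U k).mulVec (s - s')) j‖ ^ 2 := by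
          rw [← Finset.mul_sum]; field_simp
      _ ≤ Real.log (1 + b) / (Λ + 1) * (Λ + 1) := by
          gcongr
          linarith [hΛle k s hs s' hs']
      _ = _ := by field_simp
  have hsplit := Finset.sum_add_sum_compl G fun k => groupInfo X (U k) (fun j => a (k, j))
  have h1 := Finset.sum_le_card_nsmul _ _ _ hin
  have h2 := Finset.sum_le_card_nsmul Gᶜ (fun k => groupInfo X (U k) (fun j => a (k, j)))
    (N * L) fun k _ => groupInfo_le_log_card hX
  have hGK : G.card ≤ K := by
    simpa using Finset.card_le_univ G
  rw [nsmul_eq_mul] at h1 h2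
  rw [Finset.card_compl, Fintype.card_fin, Nat.cast_sub hGK] at h2
  rw [instInfo, ← div_eq_inv_mul, div_lt_iff₀ (by push_cast; positivity), ← hsplit]
  push_cast
  have h3 : G.card * (b / Real.log 2) ≤ N * (K * R - (K - G.card) * L) / 2 := by
    calc _ ≤ K * (b / Real.log 2) := by
          have : (G.card : ℝ) ≤ K := by exact_mod_cast hGK
          gcongr
      _ = _ := by rw [hb]; field_simp
  nlinarith

/-! ### CSIT noise variance, the infimum over power rules, and conditioning on the estimate. -/

theorem coe_csitNoiseVar {de ρ : ℝ} (hρ : 0 ≤ ρ) : (csitNoiseVar de ρ : ℝ) = ρ ^ (-de) :=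
  Real.coe_toNNReal _ (Real.rpow_nonneg hρ _)

theorem csitNoiseVar_ne_zero {de ρ : ℝ} (hρ : 0 < ρ) : csitNoiseVar de ρ ≠ 0 := by
  have := Real.rpow_pos_of_pos hρ (-de)
  rw [← NNReal.coe_ne_zero, coe_csitNoiseVar hρ.le]
  exact this.ne'

/-- For large SNR the variance of the channel estimate lies in `[1 / 2, 1]`. -/
theorem eventually_estimateVar {de : ℝ} (hde : 0 < de) :
    ∀ᶠ ρ : ℝ in atTop, (1 / 2 : ℝ) ≤ (1 - csitNoiseVar de ρ : ℝ≥0) := by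
  have h := (tendsto_rpow_neg_atTop hde).eventually_le_const (show (0 : ℝ) < 1 / 2 by norm_num)
  filter_upwards [h, eventually_gt_atTop 0] with ρ h1 h2
  have h3 : csitNoiseVar de ρ ≤ 1 := by
    rw [← NNReal.coe_le_coe, coe_csitNoiseVar h2.le, NNReal.coe_one]
    linarith
  rw [NNReal.coe_sub h3, coe_csitNoiseVar h2.le, NNReal.coe_one]
  linarith

theorem isPowerRule_zero (m K N : ℕ) (de ρ : ℝ) : IsPowerRule m K N de ρ fun _ _ => 0 :=
  ⟨measurable_const, fun _ _ => le_rfl, by simp⟩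

/-- The zero rule is admissible, so the infimum is finite and `toReal` loses nothing. -/
theorem le_minOutage {m K N : ℕ} {X : Finset ℂ} {U : Fin K → Matrix (Fin N) (Fin N) ℂ}
    {R de ρ x : ℝ} (h : ∀ P, IsPowerRule m K N de ρ P →
      ENNReal.ofReal x ≤ outageProb m X U R de ρ P) : x ≤ minOutage m X U R de ρ := by
  have hfin : (⨅ (P : (Fin K × Fin N → ℝ) → (Fin K × Fin N → ℝ))
      (_ : IsPowerRule m K N de ρ P), outageProb m X U R de ρ P) ≠ ∞ :=
    ne_top_of_le_ne_top ENNReal.one_ne_top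
      ((iInf₂_le _ (isPowerRule_zero m K N de ρ)).trans prob_le_one)
  exact (ENNReal.ofReal_le_iff_le_toReal hfin).1 (le_iInf₂ h)

theorem minOutage_le {m K N : ℕ} {X : Finset ℂ} {U : Fin K → Matrix (Fin N) (Fin N) ℂ}
    {R de ρ x : ℝ} (hx : 0 ≤ x) {P : (Fin K × Fin N → ℝ) → (Fin K × Fin N → ℝ)}
    (hP : IsPowerRule m K N de ρ P) (h : outageProb m X U R de ρ P ≤ ENNReal.ofReal x) :
    minOutage m X U R de ρ ≤ x :=
  ENNReal.toReal_le_of_le_ofReal hx ((iInf₂_le P hP).trans h)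

theorem mul_le_prod_of_forall_le {α β : Type*} [MeasurableSpace α] [MeasurableSpace β]
    {μ : Measure α} {ν : Measure β} [SFinite ν] {A : Set α} {E : Set (α × β)} {q : ℝ≥0∞}
    (hA : MeasurableSet A) (hE : MeasurableSet E) (h : ∀ a ∈ A, q ≤ ν (Prod.mk a ⁻¹' E)) :
    μ A * q ≤ μ.prod ν E := by
  rw [Measure.prod_apply hE, mul_comm, ← setLIntegral_const]
  exact (setLIntegral_mono' hA h).trans (setLIntegral_le_lintegral _ _)

theorem prod_le_mul_of_forall_le {α β : Type*} [MeasurableSpace α] [MeasurableSpace β]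
    {μ : Measure α} {ν : Measure β} [SFinite ν] {A : Set α} {E : Set (α × β)} {q : ℝ≥0∞}
    (hA : MeasurableSet A) (hE : MeasurableSet E) (h : ∀ a ∈ A, ν (Prod.mk a ⁻¹' E) ≤ q)
    (hsub : ∀ p ∈ E, p.1 ∈ A) : μ.prod ν E ≤ μ A * q := by
  rw [Measure.prod_apply hE, mul_comm, ← setLIntegral_const, ← lintegral_indicator hA]
  refine lintegral_mono fun a => ?_
  by_cases ha : a ∈ A
  · rw [Set.indicator_of_mem ha]; exact h a ha
  · rw [Set.indicator_of_notMem ha]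
    have : Prod.mk a ⁻¹' E = ∅ := by
      ext b
      simp only [Set.mem_preimage, Set.mem_empty_iff_false, iff_false]
      exact fun hb => ha (hsub _ hb)
    rw [this, measure_empty]

theorem exists_const_mul_rpow_le_minOutage {m K N : ℕ} (hm : 0 < m) (hN : 0 < N) {X : Finset ℂ}
    (hX : X.Nonempty) (U : Fin K → Matrix (Fin N) (Fin N) ℂ) {R de : ℝ} (hde : 0 < de)
    {G : Finset (Fin K)} (hG : G.Nonempty)
    (hR : (K - G.card) * Real.logb 2 X.card < K * R) {D : ℕ} (hD : D = m * (G.card * N)) :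
    ∃ C : ℝ, 0 < C ∧ ∀ᶠ ρ : ℝ in atTop,
      C * ρ ^ (-((D : ℝ) * (1 + D * de))) ≤ minOutage m X U R de ρ := by
  obtain ⟨κ, hκ, hout⟩ := exists_forall_instInfo_lt hN hX U hG hR
  have hK : 0 < K := Fin.pos_iff_nonempty.2 ⟨hG.choose⟩
  have hm0 : (1 : ℝ) ≤ m := by exact_mod_cast hm
  have hDpos : D ≠ 0 := by
    have := hG.card_pos
    rw [hD]; positivity
  set B : ℝ := ((K * N : ℕ) : ℝ) with hB
  have hB0 : 0 < B := by rw [hB]; exact_mod_cast Nat.mul_pos hK hN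
  set c : ℝ := Real.exp (-8) / (2 * m) with hc
  have hc0 : 0 < c := by positivity
  have hc1 : c ≤ 1 := by
    rw [hc, div_le_one (by positivity)]
    have := Real.exp_le_one_iff.2 (show (-8 : ℝ) ≤ 0 by norm_num)
    linarith
  set S := G ×ˢ (Finset.univ : Finset (Fin N)) with hS
  have hScard : m * S.card = D := by
    rw [hS, Finset.card_product, Finset.card_univ, Fintype.card_fin, hD]
  refine ⟨c ^ D / 2 * (c * (κ * c ^ D / (2 * B))) ^ D, by positivity, ?_⟩
  filter_upwards [eventually_estimateVar hde, eventually_ge_atTop 1,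
    eventually_ge_atTop (κ / (2 * B)),
    (tendsto_rpow_neg_atTop hde).eventually_le_const (show (0 : ℝ) < 1 / 2 by norm_num)]
    with ρ hv hρ1 hρκ hsmall
  have hρ0 : 0 < ρ := by linarith
  set σ : ℝ≥0 := csitNoiseVar de ρ
  set x : ℝ := ρ ^ (-de) with hx
  have hσ : (σ : ℝ) = x := coe_csitNoiseVar hρ0.le
  have hσ0 : σ ≠ 0 := csitNoiseVar_ne_zero hρ0
  have hx0 : 0 < x := Real.rpow_pos_of_pos hρ0 _
  have hv0 : (1 - σ : ℝ≥0) ≠ 0 := by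
    intro h; rw [h] at hv; norm_num at hv
  have hv1 : ((1 - σ : ℝ≥0) : ℝ) ≤ 1 := by exact_mod_cast tsub_le_self
  -- `α` bounds from below the probability that the estimates in `S` are under the noise level.
  -- Markov at `2 ρ / α` then discards at most half of it, and `y` is chosen so that the resulting
  -- power bound `2 B ρ / α` times `y` equals `κ`.
  set α : ℝ := (c * x) ^ D with hα
  have hα0 : 0 < α := by positivity
  set y : ℝ := κ * α / (2 * B * ρ) with hy
  have hy0 : 0 < y := by positivity
  have hyσ : y ≤ σ := by
    rw [hσ]
    have h1 : α ≤ x := by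
      have : c * x ≤ x := mul_le_of_le_one_left hx0.le hc1
      exact (pow_le_of_le_one (by positivity) (by linarith) hDpos).trans this
    have h2 : κ / (2 * B * ρ) ≤ 1 := by
      rw [← div_div, div_le_one hρ0]; exact hρκ
    calc y = κ / (2 * B * ρ) * α := by rw [hy]; ring
      _ ≤ 1 * α := by gcongr
      _ ≤ x := by linarith
  refine le_minOutage fun P hP => ?_
  obtain ⟨hPm, hP0, hPint⟩ := hP
  have hfm : Measurable fun g : Gains m K N => B⁻¹ * ∑ i, P (fading g) i := by
    have : ∀ i, Measurable fun g : Gains m K N => P (fading g) i := fun i =>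
      (measurable_pi_apply i).comp (hPm.comp measurable_fading)
    exact (Finset.measurable_sum _ fun i _ => this i).const_mul _
  set f : Gains m K N → ℝ := fun g => B⁻¹ * ∑ i, P (fading g) i with hf
  set μ := iidGains m K N (1 - σ)
  have hPint' : ∫⁻ g, ENNReal.ofReal (f g) ∂μ ≤ ENNReal.ofReal ρ := by
    refine le_trans (le_of_eq ?_) hPint
    exact ((measurePreserving_fst (μ := μ) (ν := iidGains m K N σ)).lintegral_comp
      hfm.ennreal_ofReal).symm
  have hfi : ∀ i, Measurable fun g : Gains m K N => fading g i := fun i =>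
    (measurable_pi_apply i).comp measurable_fading
  set A : Set (Gains m K N) := {g | ∀ i ∈ S, fading g i ≤ x}
  have hAm : MeasurableSet A := by
    have : A = ⋂ i ∈ S, {g | fading g i ≤ x} := by ext; simp [A]
    rw [this]
    exact Finset.measurableSet_biInter _ fun i _ => measurableSet_le (hfi i) measurable_const
  have hAμ : ENNReal.ofReal α ≤ μ A := by
    have h := le_iidGains_forall_fading_le (m := m) (K := K) (N := N) hv0 (z := 0) (S := S)
      (fun i _ => by simp [fading]) hx0.le (x := x) (by linarith)
    simp only [zero_add, hScard] at h
    refine le_trans (ENNReal.ofReal_le_ofReal ?_) h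
    rw [hα]
    gcongr
    rw [le_div_iff₀ (by linarith)]
    exact mul_le_of_le_one_right hx0.le hv1
  set H : Set (Gains m K N) := {g | 2 * ρ / α ≤ f g}
  have hHm : MeasurableSet H := measurableSet_le measurable_const hfm
  have hHμ : μ H ≤ ENNReal.ofReal (α / 2) := by
    have hm := meas_ge_le_lintegral_div (μ := μ) hfm.ennreal_ofReal.aemeasurable
      (ε := ENNReal.ofReal (2 * ρ / α)) (ENNReal.ofReal_pos.2 (by positivity)).ne'
      ENNReal.ofReal_ne_top
    calc μ H ≤ μ {g | ENNReal.ofReal (2 * ρ / α) ≤ ENNReal.ofReal (f g)} :=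
          measure_mono fun g hg => ENNReal.ofReal_le_ofReal hg
      _ ≤ _ := hm
      _ ≤ ENNReal.ofReal ρ / ENNReal.ofReal (2 * ρ / α) := by gcongr
      _ = ENNReal.ofReal (α / 2) := by
          rw [← ENNReal.ofReal_div_of_pos (by positivity)]
          congr 1; field_simp
  have hdiff : ENNReal.ofReal (α / 2) ≤ μ (A \ H) := by
    refine le_trans ?_ (le_measure_sdiff)
    refine le_trans (le_of_eq ?_) (tsub_le_tsub hAμ hHμ)
    rw [← ENNReal.ofReal_sub _ (by positivity)]
    congr 1; ring
  set E : Set (Gains m K N × Gains m K N) :=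
    {ω | ω.1 ∈ A \ H ∧ ∀ i ∈ S, fading (ω.1 + ω.2) i ≤ y}
  have hEm : MeasurableSet E := by
    have : E = (Prod.fst ⁻¹' (A \ H)) ∩ ⋂ i ∈ S, {ω | fading (ω.1 + ω.2) i ≤ y} := by
      ext; simp [E]
    rw [this]
    exact (measurable_fst (hAm.diff hHm)).inter (Finset.measurableSet_biInter _ fun i _ =>
      measurableSet_le ((hfi i).comp (measurable_fst.add measurable_snd)) measurable_const)
  have hEle : μ (A \ H) * ENNReal.ofReal ((c * (y / σ)) ^ D) ≤ μ.prod (iidGains m K N σ) E := by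
    refine mul_le_prod_of_forall_le (hAm.diff hHm) hEm fun g hg => ?_
    have h := le_iidGains_forall_fading_le (m := m) (K := K) (N := N) hσ0 (z := g) (S := S)
      (fun i hi => (hg.1 i hi).trans hσ.ge) hy0.le hyσ
    rw [hScard] at h
    exact h.trans (measure_mono fun e he => ⟨hg, he⟩)
  have hEout : E ⊆ {ω | instInfo X U
      (fun i => P (fading ω.1) i * fading (ω.1 + ω.2) i) < R} := by
    rintro ω ⟨⟨-, hωH⟩, hω⟩
    have hfad : ∀ i, 0 ≤ fading (ω.1 + ω.2) i := fun i => Finset.sum_nonneg fun _ _ => by positivity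
    refine hout _ (fun i => mul_nonneg (hP0 _ _) (hfad i)) fun i hi => ?_
    have hPi : P (fading ω.1) i ≤ 2 * B * ρ / α := by
      have h1 : f ω.1 < 2 * ρ / α := not_le.1 hωH
      have h2 : P (fading ω.1) i ≤ ∑ i, P (fading ω.1) i :=
        Finset.single_le_sum (f := fun i => P (fading ω.1) i) (fun _ _ => hP0 _ _)
          (Finset.mem_univ i)
      rw [hf] at h1
      simp only at h1
      rw [inv_mul_lt_iff₀ hB0] at h1
      refine h2.trans (h1.le.trans (le_of_eq (by ring)))
    calc _ ≤ 2 * B * ρ / α * y := mul_le_mul hPi (hω i hi) (hfad i) (by positivity)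
      _ = κ := by rw [hy]; field_simp
  have hfinal : c ^ D / 2 * (c * (κ * c ^ D / (2 * B))) ^ D * ρ ^ (-((D : ℝ) * (1 + D * de))) =
      α / 2 * (c * (y / σ)) ^ D := by
    have hxD : x ^ D = ρ ^ (-(de * D)) := by
      rw [hx, ← Real.rpow_natCast, ← Real.rpow_mul hρ0.le, neg_mul]
    have hpow : ρ ^ (-((D : ℝ) * (1 + D * de))) = x ^ D * (x ^ D / ρ / x) ^ D := by
      have hxDD : (x ^ D) ^ D = ρ ^ (-(de * D) * D) := by
        rw [hxD, ← Real.rpow_natCast, ← Real.rpow_mul hρ0.le]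
      rw [div_pow, div_pow, mul_div_cancel₀ _ (pow_pos hx0 D).ne', hxDD, ← Real.rpow_natCast ρ D,
        ← Real.rpow_sub hρ0]
      congr 1; ring
    rw [hpow, hσ, hy, hα]
    simp only [mul_pow, div_pow]
    field_simp
  rw [hfinal, ENNReal.ofReal_mul (by positivity)]
  exact (mul_le_mul_left hdiff _).trans (hEle.trans (measure_mono hEout))

/-! ### Achievability: a multi-level power rule -/

/-- The fading vectors for which all sub-channels of some `n` groups have gain below `x`. -/
def deepFade {K N : ℕ} (n : ℕ) (x : ℝ) : Set (Fin K × Fin N → ℝ) :=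
  {g | ∃ G ∈ (Finset.univ : Finset (Fin K)).powersetCard n,
    ∀ i ∈ G ×ˢ (Finset.univ : Finset (Fin N)), g i < x}

section DeepFade

variable {m K N n : ℕ}

theorem measurableSet_deepFade (n : ℕ) (x : ℝ) :
    MeasurableSet (deepFade n x : Set (Fin K × Fin N → ℝ)) := by
  have : (deepFade n x : Set (Fin K × Fin N → ℝ)) =
      ⋃ G ∈ (Finset.univ : Finset (Fin K)).powersetCard n,
        ⋂ i ∈ G ×ˢ (Finset.univ : Finset (Fin N)), {g | g i < x} := by
    ext g; simp [deepFade]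
  rw [this]
  exact Finset.measurableSet_biUnion _ fun G _ => Finset.measurableSet_biInter _ fun i _ =>
    measurableSet_lt (measurable_pi_apply i) measurable_const

theorem notMem_deepFade_of_imp {g g' : Fin K × Fin N → ℝ} {x x' : ℝ} (hg : g ∉ deepFade n x)
    (h : ∀ i, x ≤ g i → x' ≤ g' i) : g' ∉ deepFade n x' := by
  rintro ⟨G, hG, hlt⟩
  exact hg ⟨G, hG, fun i hi => not_le.1 fun hle => absurd (h i hle) (not_le.2 (hlt i hi))⟩

theorem deepFade_mono {x x' : ℝ} (h : x ≤ x') :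
    (deepFade n x : Set (Fin K × Fin N → ℝ)) ⊆ deepFade n x' :=
  fun _ ⟨G, hG, hlt⟩ => ⟨G, hG, fun i hi => (hlt i hi).trans_le h⟩

/-- Fewer than `K + 1 - c` groups are entirely weak, so at least `c` are not. -/
theorem le_card_of_notMem_deepFade {c : ℕ} (hc : c ≤ K) {g : Fin K × Fin N → ℝ} {x : ℝ}
    (hg : g ∉ deepFade (K + 1 - c) x) :
    c ≤ (Finset.univ.filter fun k => ∃ j, x ≤ g (k, j)).card := by
  by_contra! h
  set F := Finset.univ.filter fun k => ∃ j, x ≤ g (k, j)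
  have hF : K + 1 - c ≤ Fᶜ.card := by
    rw [Finset.card_compl, Fintype.card_fin]
    omega
  obtain ⟨G, hGF, hGc⟩ := Finset.exists_subset_card_eq hF
  refine hg ⟨G, Finset.mem_powersetCard.2 ⟨Finset.subset_univ _, hGc⟩, fun i hi => ?_⟩
  have hi' := hGF (Finset.mem_product.1 hi).1
  simp only [F, Finset.mem_compl, Finset.mem_filter, Finset.mem_univ, true_and, not_exists,
    not_le] at hi'
  exact hi' i.2

theorem iidGains_deepFade_le {v : ℝ≥0} (hv : v ≠ 0) (z : Gains m K N) (n : ℕ) {x : ℝ}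
    (hx : 0 ≤ x) : iidGains m K N v {e | fading (z + e) ∈ deepFade n x} ≤
      ENNReal.ofReal (2 ^ K * (2 * x / v) ^ (m * (n * N))) := by
  have : {e : Gains m K N | fading (z + e) ∈ deepFade n x} =
      ⋃ G ∈ (Finset.univ : Finset (Fin K)).powersetCard n,
        {e | ∀ i ∈ G ×ˢ (Finset.univ : Finset (Fin N)), fading (z + e) i < x} := by
    ext e; simp [deepFade]
  rw [this]
  refine (measure_biUnion_finset_le _ _).trans ?_
  refine (Finset.sum_le_card_nsmul _ _ (ENNReal.ofReal ((2 * x / v) ^ (m * (n * N))))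
    fun G hG => ?_).trans ?_
  · refine (iidGains_forall_fading_lt_le hv z _ hx).trans (le_of_eq ?_)
    rw [Finset.card_product, (Finset.mem_powersetCard.1 hG).2, Finset.card_univ, Fintype.card_fin]
  · rw [nsmul_eq_mul, ENNReal.ofReal_mul (by positivity)]
    gcongr
    rw [← ENNReal.ofReal_natCast]
    refine ENNReal.ofReal_le_ofReal ?_
    rw [Finset.card_powersetCard, Finset.card_univ, Fintype.card_fin]
    exact_mod_cast Nat.choose_le_two_pow K n

/-- The parallelogram law gives `‖g‖² ≤ 2 ‖g + e‖² + 2 ‖e‖²`. -/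
theorem le_fading_add {g e : Gains m K N} {i : Fin K × Fin N} {t : ℝ} (hg : t ≤ fading g i)
    (he : fading e i ≤ t / 4) : t / 4 ≤ fading (g + e) i := by
  have h : fading g i ≤ 2 * fading (g + e) i + 2 * fading e i := by
    simp only [fading, Finset.mul_sum, ← Finset.sum_add_distrib]
    refine Finset.sum_le_sum fun r _ => ?_
    have := parallelogram_law_with_norm ℝ (g i r + e i r) (e i r)
    rw [add_sub_cancel_right] at this
    simp only [Pi.add_apply]
    nlinarith [mul_self_nonneg ‖g i r + e i r + e i r‖]
  linarith

end DeepFade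

/-- A function that gains `r / y j` on the event `A j`. -/
noncomputable def levelSum {α : Type*} (r : ℝ) (n : ℕ) (y : ℕ → ℝ) (A : ℕ → Set α) (a : α) : ℝ :=
  r * (1 + ∑ j ∈ Finset.range n, (A j).indicator (fun _ => (y j)⁻¹) a)

section LevelSum

variable {α : Type*} {r : ℝ} {n : ℕ} {y : ℕ → ℝ} {A : ℕ → Set α}

theorem measurable_levelSum [MeasurableSpace α] (hA : ∀ j, MeasurableSet (A j)) :
    Measurable (levelSum r n y A) := by
  unfold levelSum
  exact (measurable_const.add (Finset.measurable_sum _ fun j _ =>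
    measurable_const.indicator (hA j))).const_mul r

theorem le_levelSum (hr : 0 ≤ r) (hy : ∀ j, 0 < y j) (a : α) : r ≤ levelSum r n y A a := by
  have : 0 ≤ ∑ j ∈ Finset.range n, (A j).indicator (fun _ => (y j)⁻¹) a :=
    Finset.sum_nonneg fun j _ => Set.indicator_nonneg (fun _ _ => (inv_pos.2 (hy j)).le) a
  unfold levelSum
  nlinarith

theorem div_le_levelSum (hr : 0 ≤ r) (hy : ∀ j, 0 < y j) {j : ℕ} (hj : j < n) {a : α}
    (ha : a ∈ A j) : r / y j ≤ levelSum r n y A a := by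
  have : (y j)⁻¹ ≤ ∑ j ∈ Finset.range n, (A j).indicator (fun _ => (y j)⁻¹) a := by
    have h := Finset.single_le_sum (f := fun j => (A j).indicator (fun _ => (y j)⁻¹) a)
      (fun j _ => Set.indicator_nonneg (fun _ _ => (inv_pos.2 (hy j)).le) a)
      (Finset.mem_range.2 hj)
    simpa only [Set.indicator_of_mem ha] using h
  unfold levelSum
  rw [div_eq_mul_inv]
  gcongr
  linarith

/-- Each level costs at most `r * C` on average, since its weight `1 / y j` cancels the probability
bound `C * y j`. -/
theorem lintegral_levelSum_le [MeasurableSpace α] {μ : Measure α} [IsProbabilityMeasure μ]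
    (hr : 0 ≤ r) (hy : ∀ j, 0 < y j) (hA : ∀ j, MeasurableSet (A j)) {C : ℝ} (hC : 0 ≤ C)
    (hμ : ∀ j, μ (A j) ≤ ENNReal.ofReal (C * y j)) :
    ∫⁻ a, ENNReal.ofReal (levelSum r n y A a) ∂μ ≤ ENNReal.ofReal (r * (1 + n * C)) := by
  have hind : ∀ a, ENNReal.ofReal (levelSum r n y A a) = ENNReal.ofReal r *
      (1 + ∑ j ∈ Finset.range n, (A j).indicator (fun _ => ENNReal.ofReal (y j)⁻¹) a) := by
    intro a
    have h0 : ∀ j, 0 ≤ (A j).indicator (fun _ => (y j)⁻¹) a := fun j =>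
      Set.indicator_nonneg (fun _ _ => (inv_pos.2 (hy j)).le) a
    rw [levelSum, ENNReal.ofReal_mul hr, ENNReal.ofReal_add zero_le_one
      (Finset.sum_nonneg fun j _ => h0 j), ENNReal.ofReal_one,
      ENNReal.ofReal_sum_of_nonneg fun j _ => h0 j]
    congr 2
    refine Finset.sum_congr rfl fun j _ => ?_
    by_cases h : a ∈ A j <;> simp [h]
  simp only [hind]
  have hm : ∀ j ∈ Finset.range n,
      Measurable ((A j).indicator fun _ => ENNReal.ofReal (y j)⁻¹) := fun j _ =>
    measurable_const.indicator (hA j)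
  rw [lintegral_const_mul' _ _ ENNReal.ofReal_ne_top, lintegral_add_left measurable_const,
    lintegral_finsetSum _ hm, lintegral_one, measure_univ, ENNReal.ofReal_mul hr]
  gcongr
  rw [ENNReal.ofReal_add zero_le_one (by positivity), ENNReal.ofReal_one,
    ENNReal.ofReal_mul (by positivity), ENNReal.ofReal_natCast]
  gcongr
  refine (Finset.sum_le_card_nsmul _ _ (ENNReal.ofReal C) fun j _ => ?_).trans
    (le_of_eq (by rw [Finset.card_range, nsmul_eq_mul]))
  rw [lintegral_indicator_const (hA j)]
  calc _ ≤ ENNReal.ofReal (y j)⁻¹ * ENNReal.ofReal (C * y j) := by gcongr; exact hμ j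
    _ = ENNReal.ofReal C := by
      rw [← ENNReal.ofReal_mul (inv_pos.2 (hy j)).le]
      congr 1
      have := (hy j).ne'
      field_simp

end LevelSum

theorem eventually_const_mul_rpow_le {a b C C' : ℝ} (hab : a < b) (hC' : 0 < C') :
    ∀ᶠ ρ : ℝ in atTop, C * ρ ^ a ≤ C' * ρ ^ b := by
  have h : Tendsto (fun ρ : ℝ => C * ρ ^ (-(b - a))) atTop (𝓝 0) := by
    simpa using (tendsto_rpow_neg_atTop (sub_pos.2 hab)).const_mul C
  filter_upwards [h.eventually_le_const hC', eventually_gt_atTop 0] with ρ h1 h2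
  have : ρ ^ a = ρ ^ (-(b - a)) * ρ ^ b := by rw [← Real.rpow_add h2]; congr 1; ring
  rw [this, ← mul_assoc]
  gcongr

/-- The power allocated to all sub-channels: large when some `n` groups are estimated to be in a
deep fade, with the levels `ρ ^ (-θ j)` for the depth of the fade. -/
noncomputable def levelPower {K N : ℕ} (n D J : ℕ) (κ θ ρ : ℝ) : (Fin K × Fin N → ℝ) → ℝ :=
  levelSum (κ * ρ) (J + 1) (fun j => (ρ ^ (-(θ * j))) ^ D) fun j => deepFade n (ρ ^ (-(θ * j)))

theorem isPowerRule_levelPower {m K N n D J : ℕ} (hKN : 0 < K * N) (hD : D = m * (n * N))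
    {de ρ κ θ : ℝ} (hρ : 0 < ρ) (hv : (1 / 2 : ℝ) ≤ (1 - csitNoiseVar de ρ : ℝ≥0)) (hκ : 0 < κ)
    (hκJ : κ * (1 + (J + 1) * (2 ^ K * 4 ^ D)) ≤ 1) :
    IsPowerRule m K N de ρ fun g _ => levelPower n D J κ θ ρ g := by
  have hy : ∀ j : ℕ, 0 < (ρ ^ (-(θ * j))) ^ D := fun j => by positivity
  have hmeas : Measurable (levelPower n D J κ θ ρ : (Fin K × Fin N → ℝ) → ℝ) :=
    measurable_levelSum fun j => measurableSet_deepFade _ _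
  refine ⟨measurable_pi_lambda _ fun _ => hmeas, fun g _ => ?_, ?_⟩
  · exact le_trans (by positivity) (le_levelSum (by positivity) hy g)
  · have hsum : ∀ ω : Gains m K N × Gains m K N, ((K * N : ℕ) : ℝ)⁻¹ *
        ∑ _i : Fin K × Fin N, levelPower n D J κ θ ρ (fading ω.1) =
        levelPower n D J κ θ ρ (fading ω.1) := by
      intro ω
      rw [Finset.sum_const, Finset.card_univ, Fintype.card_prod, Fintype.card_fin,
        Fintype.card_fin, nsmul_eq_mul]
      exact inv_mul_cancel_left₀ (by positivity) _
    simp only [hsum]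
    set σ := csitNoiseVar de ρ
    have hv0 : (1 - σ : ℝ≥0) ≠ 0 := by
      intro h; rw [h] at hv; norm_num at hv
    set μ := iidGains m K N (1 - σ)
    have hprod : ∫⁻ ω : Gains m K N × Gains m K N,
        ENNReal.ofReal (levelPower n D J κ θ ρ (fading ω.1)) ∂csitLaw m K N de ρ =
        ∫⁻ g, ENNReal.ofReal (levelPower n D J κ θ ρ (fading g)) ∂μ :=
      (measurePreserving_fst (μ := μ) (ν := iidGains m K N σ)).lintegral_comp
        (hmeas.comp measurable_fading).ennreal_ofReal
    have hpre : ∀ g : Gains m K N, levelPower n D J κ θ ρ (fading g) =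
        levelSum (κ * ρ) (J + 1) (fun j => (ρ ^ (-(θ * j))) ^ D)
          (fun j => fading ⁻¹' deepFade n (ρ ^ (-(θ * j)))) g := fun g => rfl
    rw [hprod]
    simp only [hpre]
    refine (lintegral_levelSum_le (C := 2 ^ K * 4 ^ D) (by positivity) hy
      (fun j => measurable_fading (measurableSet_deepFade _ _)) (by positivity) fun j => ?_).trans ?_
    · have hx : 0 < ρ ^ (-(θ * j)) := Real.rpow_pos_of_pos hρ _
      have h := iidGains_deepFade_le hv0 (0 : Gains m K N) n hx.le
      simp only [zero_add, ← hD] at h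
      refine h.trans (ENNReal.ofReal_le_ofReal ?_)
      rw [mul_assoc, ← mul_pow]
      gcongr
      rw [div_le_iff₀ (by linarith)]
      nlinarith
    · refine ENNReal.ofReal_le_ofReal ?_
      push_cast
      calc _ = κ * (1 + (J + 1) * (2 ^ K * 4 ^ D)) * ρ := by ring
        _ ≤ 1 * ρ := by gcongr
        _ = ρ := one_mul ρ

/-- Take the first level `j` at which the estimate is not faded. The power is that of level `j - 1`
(or the base power), and one grid step loses only `ρ ^ (-θ)`, so power times gain stays at least of
order `ρ ^ (1 - θ)`. -/
theorem exists_level_of_notMem_deepFade {K N n D J : ℕ} (hD : D ≠ 0) {κ θ ρ : ℝ} (hκ : 0 < κ)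
    (hθ0 : 0 ≤ θ) (hθ : θ ≤ 1 / 2) (hρ : 1 ≤ ρ) {g : Fin K × Fin N → ℝ}
    (hg : g ∉ deepFade n (ρ ^ (-(θ * J)))) :
    ∃ j ≤ J, g ∉ deepFade n (ρ ^ (-(θ * j))) ∧
      κ * ρ ^ (1 / 2 : ℝ) ≤ levelPower n D J κ θ ρ g * ρ ^ (-(θ * j)) := by
  classical
  have hρ0 : 0 < ρ := by linarith
  have hy : ∀ j : ℕ, 0 < (ρ ^ (-(θ * j))) ^ D := fun j => by positivity
  have hex : ∃ j : ℕ, g ∉ deepFade n (ρ ^ (-(θ * j))) := ⟨J, hg⟩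
  refine ⟨Nat.find hex, Nat.find_min' hex hg, Nat.find_spec hex, ?_⟩
  rcases hj : Nat.find hex with _ | i
  · have h1 : κ * ρ ≤ levelPower n D J κ θ ρ g := le_levelSum (by positivity) hy g
    have h2 : ρ ^ (1 / 2 : ℝ) ≤ ρ ^ (1 : ℝ) := Real.rpow_le_rpow_of_exponent_le hρ (by norm_num)
    rw [Real.rpow_one] at h2
    simp only [Nat.cast_zero, mul_zero, neg_zero, Real.rpow_zero, mul_one]
    exact le_trans (by gcongr) h1
  · have hi : g ∈ deepFade n (ρ ^ (-(θ * i))) := by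
      by_contra h
      have := Nat.find_min' hex h
      omega
    have hiJ : i < J + 1 := by
      have := Nat.find_min' hex hg
      omega
    have h1 : κ * ρ / (ρ ^ (-(θ * i))) ^ D ≤ levelPower n D J κ θ ρ g :=
      div_le_levelSum (by positivity) hy hiJ hi
    set x := ρ ^ (-(θ * i)) with hx
    have hx0 : 0 < x := Real.rpow_pos_of_pos hρ0 _
    have hx1 : x ≤ 1 := Real.rpow_le_one_of_one_le_of_nonpos hρ
      (neg_nonpos.2 (by positivity))
    have hxx : ρ ^ (-(θ * ((i + 1 : ℕ) : ℝ))) = x * ρ ^ (-θ) := by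
      rw [hx, ← Real.rpow_add hρ0]; push_cast; congr 1; ring
    have hxD : x ^ D ≤ x := pow_le_of_le_one hx0.le hx1 hD
    rw [hxx]
    calc κ * ρ ^ (1 / 2 : ℝ) ≤ κ * ρ ^ (1 + -θ) := by
          gcongr
          linarith
      _ = κ * ρ / x * (x * ρ ^ (-θ)) := by
          rw [Real.rpow_add hρ0, Real.rpow_one]; field_simp
      _ ≤ κ * ρ / x ^ D * (x * ρ ^ (-θ)) := by gcongr
      _ ≤ _ := by gcongr

/-! ### Probabilities of the three bad events of the achievability proof. -/

section CsitLaw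

variable {m K N n D : ℕ} {de ρ : ℝ}

theorem measurable_fading_apply (i : Fin K × Fin N) :
    Measurable fun g : Gains m K N => fading g i :=
  (measurable_pi_apply i).comp measurable_fading

theorem csitLaw_deepFade_le (hD : D = m * (n * N)) (hρ : 0 < ρ)
    (hv : (1 / 2 : ℝ) ≤ (1 - csitNoiseVar de ρ : ℝ≥0)) {x y : ℝ} (hx : 0 ≤ x) (hy : 0 ≤ y) :
    csitLaw m K N de ρ {ω | fading ω.1 ∈ deepFade n x ∧ fading (ω.1 + ω.2) ∈ deepFade n y} ≤
      ENNReal.ofReal (2 ^ K * (4 * x) ^ D * (2 ^ K * (2 * y / ρ ^ (-de)) ^ D)) := by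
  have hv0 : (1 - csitNoiseVar de ρ : ℝ≥0) ≠ 0 := by
    intro h; rw [h] at hv; norm_num at hv
  have hE : MeasurableSet {ω : Gains m K N × Gains m K N |
      fading ω.1 ∈ deepFade n x ∧ fading (ω.1 + ω.2) ∈ deepFade n y} :=
    (measurable_fading.comp measurable_fst (measurableSet_deepFade _ _)).inter
      (measurable_fading.comp (measurable_fst.add measurable_snd) (measurableSet_deepFade _ _))
  refine (prod_le_mul_of_forall_le (q := ENNReal.ofReal (2 ^ K * (2 * y / ρ ^ (-de)) ^ D))
    (measurable_fading (measurableSet_deepFade n x)) hE (fun g _ => ?_) fun _ h => h.1).trans ?_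
  · have h := iidGains_deepFade_le (csitNoiseVar_ne_zero (de := de) hρ) g n hy
    rw [← hD, coe_csitNoiseVar hρ.le] at h
    exact (measure_mono fun e he => he.2).trans h
  · have h := iidGains_deepFade_le hv0 (0 : Gains m K N) n hx
    simp only [zero_add, ← hD] at h
    have h4 : 2 * x / (1 - csitNoiseVar de ρ : ℝ≥0) ≤ 4 * x := by
      rw [div_le_iff₀ (by linarith)]; nlinarith
    rw [ENNReal.ofReal_mul (p := 2 ^ K * (4 * x) ^ D) (by positivity)]
    refine mul_le_mul' (h.trans (ENNReal.ofReal_le_ofReal ?_)) le_rfl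
    gcongr

theorem csitLaw_exists_error_gt_le (hρ : 0 < ρ) {y : ℝ} (hy : 0 ≤ y) :
    csitLaw m K N de ρ {ω | ∃ i, y < fading ω.2 i} ≤
      ENNReal.ofReal ((K * N : ℕ) * (m * (4 * Real.exp (-(y / (2 * m * ρ ^ (-de))))))) := by
  have hE : MeasurableSet {ω : Gains m K N × Gains m K N | ∃ i, y < fading ω.2 i} := by
    rw [Set.ofPred_exists]
    exact MeasurableSet.iUnion fun i => measurableSet_lt measurable_const
      ((measurable_fading_apply i).comp measurable_snd)
  refine (prod_le_mul_of_forall_le (A := Set.univ) .univ hE (fun g _ => ?_)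
    fun _ _ => Set.mem_univ _).trans (by rw [measure_univ, one_mul])
  rw [← coe_csitNoiseVar hρ.le]
  exact iidGains_exists_fading_gt_le hy

theorem csitLaw_exists_fading_lt_le (hρ : 0 < ρ) {x : ℝ} (hx : 0 ≤ x) :
    csitLaw m K N de ρ {ω | ∃ i, fading (ω.1 + ω.2) i < x} ≤
      ENNReal.ofReal ((K * N : ℕ) * (2 * x / ρ ^ (-de)) ^ m) := by
  have hE : MeasurableSet {ω : Gains m K N × Gains m K N | ∃ i, fading (ω.1 + ω.2) i < x} := by
    rw [Set.ofPred_exists]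
    exact MeasurableSet.iUnion fun i => measurableSet_lt
      ((measurable_fading_apply i).comp (measurable_fst.add measurable_snd)) measurable_const
  refine (prod_le_mul_of_forall_le (A := Set.univ) .univ hE (fun g _ => ?_)
    fun _ _ => Set.mem_univ _).trans (by rw [measure_univ, one_mul])
  rw [← coe_csitNoiseVar hρ.le]
  exact iidGains_exists_fading_lt_le (csitNoiseVar_ne_zero hρ) g hx

end CsitLaw

theorem eventually_minOutage_le {m K N : ℕ} (hm : 0 < m) (hK : 0 < K) (hN : 0 < N) {X : Finset ℂ}
    (hX : 1 < X.card) {U : Fin K → Matrix (Fin N) (Fin N) ℂ}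
    (hdiv : ∀ k, IsFullDiversity X (U k)) {R : ℝ} (hR : R < Real.logb 2 X.card) {c : ℕ}
    (hcK : c ≤ K) (hc : K * R ≤ c * Real.logb 2 X.card) {de : ℝ} (hde : 0 < de) {D : ℕ}
    (hD : D = m * ((K + 1 - c) * N)) {ε : ℝ} (hε : 0 < ε) :
    ∀ᶠ ρ : ℝ in atTop, minOutage m X U R de ρ ≤ ρ ^ (-((D : ℝ) * (1 + D * de)) + ε) := by
  set n := K + 1 - c with hn
  have hD0 : D ≠ 0 := by
    have : 0 < n := by omega
    rw [hD]; positivity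
  have hDpos : (0 : ℝ) < D := by exact_mod_cast Nat.pos_of_ne_zero hD0
  have hm0 : (1 : ℝ) ≤ m := by exact_mod_cast hm
  have hKN : 0 < K * N := Nat.mul_pos hK hN
  -- The term `D * (2 * δ + δ * D)` is exactly the exponent lost by stopping at `ρ ^ (-(de - δ))`
  -- and asking for SNR `ρ ^ δ`; `δ ≤ 1 / 4` keeps `4 ρ ^ δ` below `κ ρ ^ (1 / 2)` for large `ρ`.
  obtain ⟨δ, hδ0, hδ1, hδde, hδε⟩ : ∃ δ : ℝ, 0 < δ ∧ δ ≤ 1 / 4 ∧ δ < de ∧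
      D * (2 * δ + δ * D) ≤ ε / 2 := by
    refine ⟨min (min (1 / 4) (de / 2)) (ε / (2 * (D * (2 + D)))), by positivity,
      (min_le_left _ _).trans (min_le_left _ _),
      ((min_le_left _ _).trans (min_le_right _ _)).trans_lt (by linarith), ?_⟩
    set δ := min (min (1 / 4) (de / 2)) (ε / (2 * (D * (2 + D))))
    have h : δ ≤ ε / (2 * (D * (2 + D))) := min_le_right _ _
    calc D * (2 * δ + δ * D) = δ * (D * (2 + D)) := by ring
      _ ≤ ε / (2 * (D * (2 + D))) * (D * (2 + D)) := by gcongr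
      _ = ε / 2 := by field_simp
  -- Enough levels for the grid step `θ = (de - δ) / J` to be at most `1 / 2`.
  set J : ℕ := ⌈2 * de⌉₊ with hJ
  have hJde : 2 * de ≤ J := Nat.le_ceil _
  have hJ0 : (0 : ℝ) < J := by linarith
  set θ : ℝ := (de - δ) / J with hθ
  have hθ0 : 0 ≤ θ := div_nonneg (by linarith) hJ0.le
  have hθ1 : θ ≤ 1 / 2 := by rw [hθ, div_le_iff₀ hJ0]; linarith
  have hθJ : θ * J = de - δ := by rw [hθ]; field_simp
  set κ : ℝ := (1 + (J + 1) * (2 ^ K * 4 ^ D))⁻¹ with hκ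
  have hκ0 : 0 < κ := by positivity
  set E : ℝ := D * (1 + D * de) with hE
  have hE0 : 0 < E := by positivity
  -- Even relative to the CSIT noise variance alone, a gain below `ρ ^ (-Q)` has probability `O (ρ ^
  -- (-(E + 1) * m))`, which is negligible.
  set Q : ℝ := de + E + 1 with hQ
  have hQ0 : 0 < Q := by positivity
  set C₁ : ℝ := 2 ^ K * 4 ^ D * (2 ^ K * (2 / κ) ^ D) with hC₁
  set b : ℝ := 1 / (8 * m) with hb
  have hb0 : 0 < b := by positivity
  filter_upwards [eventually_le_instInfo hK hN hX hdiv hR hc hδ0 hQ0, eventually_estimateVar hde,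
    eventually_ge_atTop 1, eventually_ge_atTop κ⁻¹,
    eventually_const_mul_rpow_le (a := δ) (b := 1 / 2) (C := 4) (by linarith) hκ0,
    eventually_const_mul_rpow_le (a := -E + ε / 2) (b := -E + ε) (C := C₁) (C' := 1 / 3)
      (by linarith) (by norm_num),
    eventually_exp_neg_rpow_le hb0 hδ0 (C := 1 / (3 * ((K * N : ℕ) * (m * 4)))) (by positivity)
      (E - ε),
    eventually_const_mul_rpow_le (a := -(E + 1) * m) (b := -E + ε) (C := (K * N : ℕ) * 2 ^ m)
      (C' := 1 / 3) (by nlinarith) (by norm_num)]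
    with ρ hgood hv hρ1 hρκ hlev hE₁ hE₂ hE₃
  have hρ0 : 0 < ρ := by linarith
  have hκρ : 1 ≤ κ * ρ := by
    have := mul_le_mul_of_nonneg_left hρκ hκ0.le
    rwa [mul_inv_cancel₀ hκ0.ne'] at this
  have hrule := isPowerRule_levelPower (m := m) (K := K) (N := N) (n := n) (D := D) (J := J)
    (de := de) (θ := θ) hKN hD hρ0 hv hκ0 (inv_mul_cancel₀ (by positivity)).le
  refine minOutage_le (Real.rpow_nonneg hρ0.le _) hrule ?_
  set p : (Fin K × Fin N → ℝ) → ℝ := levelPower n D J κ θ ρ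
  have hpow : ∀ j : ℕ, 0 < (ρ ^ (-(θ * j))) ^ D := fun j => by positivity
  have hpκ : ∀ g, κ * ρ ≤ p g := fun g => le_levelSum (by positivity) hpow g
  have hp1 : ∀ g, 1 ≤ p g := fun g => hκρ.trans (hpκ g)
  set τ : ℝ := ρ ^ (-(θ * J)) with hτ
  have hτ0 : 0 < τ := Real.rpow_pos_of_pos hρ0 _
  set y : ℝ := ρ ^ δ / (κ * ρ / τ ^ D) with hy
  have hy0 : 0 < y := by positivity
  set E₁ : Set (Gains m K N × Gains m K N) :=
    {ω | fading ω.1 ∈ deepFade n τ ∧ fading (ω.1 + ω.2) ∈ deepFade n y} with hE₁def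
  set E₂ : Set (Gains m K N × Gains m K N) := {ω | ∃ i, τ / 4 < fading ω.2 i} with hE₂def
  set E₃ : Set (Gains m K N × Gains m K N) :=
    {ω | ∃ i, fading (ω.1 + ω.2) i < ρ ^ (-Q)} with hE₃def
  -- `E₁` is the genuine outage, with estimate and true channel both deeply faded; `E₂` is an
  -- atypically large estimation error; `E₃` is a vanishing sub-channel. Outside `E₂` and `E₃`,
  -- outage forces a true fade below `ρ ^ δ / P`, which an estimate above `τ` excludes.
  have hsub : {ω : Gains m K N × Gains m K N | instInfo X U
      (fun i => p (fading ω.1) * fading (ω.1 + ω.2) i) < R} ⊆ E₁ ∪ (E₂ ∪ E₃) := by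
    intro ω hω
    by_contra hnot
    simp only [Set.mem_union, not_or] at hnot
    obtain ⟨h1, h2, h3⟩ := hnot
    simp only [hE₂def, hE₃def, Set.mem_ofPred_eq, not_exists, not_lt] at h2 h3
    set P := p (fading ω.1)
    have hP0 : 0 < P := by linarith [hp1 (fading ω.1)]
    have hdeep : fading (ω.1 + ω.2) ∈ deepFade n (ρ ^ δ / P) := by
      by_contra hno
      refine absurd (hgood _ (fun i => ?_) (le_card_of_notMem_deepFade hcK
        (notMem_deepFade_of_imp hno fun i hi => ?_))) (not_le.2 hω)
      · exact (h3 i).trans (le_mul_of_one_le_left ((Real.rpow_nonneg hρ0.le _).trans (h3 i))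
          (hp1 _))
      · rwa [div_le_iff₀' hP0] at hi
    by_cases hest : fading ω.1 ∈ deepFade n τ
    · refine h1 ⟨hest, deepFade_mono ?_ hdeep⟩
      have hPτ : κ * ρ / τ ^ D ≤ P := div_le_levelSum (by positivity) hpow (Nat.lt_succ_self J) hest
      rw [hy]
      gcongr
    · obtain ⟨j, hjJ, hj, hlevel⟩ := exists_level_of_notMem_deepFade hD0 hκ0 hθ0 hθ1 hρ1 hest
      set x := ρ ^ (-(θ * j)) with hx
      have hτx : τ ≤ x := Real.rpow_le_rpow_of_exponent_le hρ1 (by gcongr)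
      have hno : fading (ω.1 + ω.2) ∉ deepFade n (x / 4) :=
        notMem_deepFade_of_imp hj fun i hi => le_fading_add hi ((h2 i).trans (by linarith))
      refine hno (deepFade_mono ?_ hdeep)
      rw [div_le_iff₀ hP0]
      change κ * ρ ^ (1 / 2 : ℝ) ≤ P * x at hlevel
      linarith
  set F : ℝ := ρ ^ (-E + ε) with hF
  have hb₁ : csitLaw m K N de ρ E₁ ≤ ENNReal.ofReal (1 / 3 * F) := by
    refine (csitLaw_deepFade_le hD hρ0 hv hτ0.le hy0.le).trans
      (ENNReal.ofReal_le_ofReal (le_trans ?_ hE₁))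
    have hrw : τ * y / ρ ^ (-de) = κ⁻¹ * ρ ^ (-(de - δ) * D + 2 * δ - 1) := by
      have hτD : τ ^ D = ρ ^ (-(de - δ) * D) := by
        rw [hτ, hθJ, ← Real.rpow_natCast, ← Real.rpow_mul hρ0.le]
      have : ρ ^ (-(de - δ) * D + 2 * δ - 1) =
          ρ ^ (-(de - δ)) * (ρ ^ δ * ρ ^ (-(de - δ) * D) / ρ) / ρ ^ (-de) := by
        rw [← Real.rpow_add hρ0, ← Real.rpow_sub_one hρ0.ne', ← Real.rpow_add hρ0,
          ← Real.rpow_sub hρ0]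
        congr 1; ring
      rw [this, hy, hτD, hτ, hθJ]
      field_simp
    calc 2 ^ K * (4 * τ) ^ D * (2 ^ K * (2 * y / ρ ^ (-de)) ^ D)
        = 2 ^ K * 4 ^ D * (2 ^ K * 2 ^ D) * (τ * y / ρ ^ (-de)) ^ D := by
          simp only [mul_pow, div_pow]; ring
      _ = C₁ * ρ ^ ((-(de - δ) * D + 2 * δ - 1) * D) := by
          rw [hrw, mul_pow, Real.rpow_mul hρ0.le, Real.rpow_natCast, hC₁, div_pow, inv_pow]
          field_simp
      _ ≤ C₁ * ρ ^ (-E + ε / 2) := by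
          gcongr
          rw [hE]; nlinarith
  have hb₂ : csitLaw m K N de ρ E₂ ≤ ENNReal.ofReal (1 / 3 * F) := by
    refine (csitLaw_exists_error_gt_le hρ0 (by positivity)).trans (ENNReal.ofReal_le_ofReal ?_)
    have hexp : τ / 4 / (2 * m * ρ ^ (-de)) = b * ρ ^ δ := by
      have : ρ ^ δ = τ / ρ ^ (-de) := by
        rw [hτ, hθJ, ← Real.rpow_sub hρ0]; congr 1; ring
      rw [this, hb]
      ring
    rw [hexp]
    have hKN0 : (0 : ℝ) < (K * N : ℕ) := by exact_mod_cast hKN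
    calc _ ≤ (K * N : ℕ) * (m * (4 * (1 / (3 * ((K * N : ℕ) * (m * 4))) * ρ ^ (-(E - ε))))) := by
          gcongr
      _ = 1 / 3 * F := by
          rw [hF, show -(E - ε) = -E + ε by ring]
          generalize ((K * N : ℕ) : ℝ) = B at hKN0
          field_simp
  have hb₃ : csitLaw m K N de ρ E₃ ≤ ENNReal.ofReal (1 / 3 * F) := by
    refine (csitLaw_exists_fading_lt_le hρ0 (Real.rpow_nonneg hρ0.le _)).trans
      (ENNReal.ofReal_le_ofReal (le_trans (le_of_eq ?_) hE₃))
    rw [mul_div_assoc, mul_pow, ← Real.rpow_sub hρ0, Real.rpow_mul hρ0.le, Real.rpow_natCast,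
      mul_assoc]
    congr 4
    rw [hQ]; ring
  have hF0 : 0 ≤ F := Real.rpow_nonneg hρ0.le _
  calc outageProb m X U R de ρ (fun g _ => p g) ≤ csitLaw m K N de ρ (E₁ ∪ (E₂ ∪ E₃)) :=
        measure_mono hsub
    _ ≤ csitLaw m K N de ρ E₁ + (csitLaw m K N de ρ E₂ + csitLaw m K N de ρ E₃) :=
        (measure_union_le _ _).trans (add_le_add le_rfl (measure_union_le _ _))
    _ ≤ ENNReal.ofReal (1 / 3 * F) + (ENNReal.ofReal (1 / 3 * F) + ENNReal.ofReal (1 / 3 * F)) :=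
        add_le_add hb₁ (add_le_add hb₂ hb₃)
    _ = ENNReal.ofReal F := by
        rw [← ENNReal.ofReal_add (by positivity) (by positivity),
          ← ENNReal.ofReal_add (by positivity) (by positivity)]
        congr 1; ring

/-! ### The outage exponent -/

theorem tendsto_neg_log_div_log {p : ℝ → ℝ} {E C : ℝ} (hC : 0 < C)
    (hlow : ∀ᶠ ρ in atTop, C * ρ ^ (-E) ≤ p ρ)
    (hup : ∀ ε > 0, ∀ᶠ ρ in atTop, p ρ ≤ ρ ^ (-E + ε)) :
    Tendsto (fun ρ => -Real.log (p ρ) / Real.log ρ) atTop (𝓝 E) := by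
  rw [tendsto_order]
  constructor
  · intro e he
    filter_upwards [hup ((E - e) / 2) (by linarith), hlow, eventually_gt_atTop 1] with ρ h1 h2 h3
    have h0 : 0 < ρ := by linarith
    have hp : 0 < p ρ := lt_of_lt_of_le (by positivity) h2
    have hlog := Real.log_pos h3
    have h4 := Real.log_le_log hp h1
    rw [Real.log_rpow h0] at h4
    rw [lt_div_iff₀ hlog]
    nlinarith
  · intro e he
    have hbig : ∀ᶠ ρ in atTop, -Real.log C / ((e - E) / 2) ≤ Real.log ρ :=
      Real.tendsto_log_atTop.eventually_ge_atTop _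
    filter_upwards [hbig, hlow, eventually_gt_atTop 1] with ρ h1 h2 h3
    have h0 : 0 < ρ := by linarith
    have hlog := Real.log_pos h3
    have h4 := Real.log_le_log (by positivity) h2
    rw [Real.log_mul hC.ne' (by positivity), Real.log_rpow h0] at h4
    rw [div_le_iff₀ (by linarith)] at h1
    rw [div_lt_iff₀ hlog]
    nlinarith

/-- Since `B = K N`, the ceiling is that of `K R / M`. Its two defining inequalities are the rate
conditions of achievability (`c` groups suffice) and of the converse (`c - 1` do not). -/
theorem exists_ceil_rate {K N M : ℕ} (hN : 0 < N) (hK : 0 < K) {R : ℝ} (hR0 : 0 < R)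
    (hRM : R < M) : ∃ c : ℕ, 1 ≤ c ∧ c ≤ K ∧ K * R ≤ c * M ∧ ((c : ℝ) - 1) * M < K * R ∧
      dSBrot (K * N) N M R = ((K + 1 - c : ℕ) : ℝ) * N := by
  have hN0 : (0 : ℝ) < N := by exact_mod_cast hN
  have hK0 : (0 : ℝ) < K := by exact_mod_cast hK
  have hM0 : (0 : ℝ) < M := hR0.trans hRM
  have hx : ((K * N : ℕ) : ℝ) * R / (M * N) = K * R / M := by push_cast; field_simp
  have hpos : 0 < K * R / M := by positivity
  have hcpos : 0 < ⌈K * R / M⌉ := Int.ceil_pos.2 hpos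
  obtain ⟨c, hc⟩ := Int.eq_ofNat_of_zero_le hcpos.le
  have h1 : K * R / M ≤ c := by
    have := Int.le_ceil (K * R / M); rw [hc] at this; exact_mod_cast this
  have h2 : (c : ℝ) < K * R / M + 1 := by
    have := Int.ceil_lt_add_one (K * R / M); rw [hc] at this; exact_mod_cast this
  have hcK : c ≤ K := by
    have h3 : ⌈K * R / M⌉ ≤ (K : ℤ) := by
      rw [Int.ceil_le, div_le_iff₀ hM0]
      push_cast
      gcongr
    rw [hc] at h3
    exact_mod_cast h3
  refine ⟨c, by omega, hcK, (div_le_iff₀ hM0).1 h1, ?_, ?_⟩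
  · rw [← lt_div_iff₀ hM0]; linarith
  · rw [dSBrot, hx, hc, Nat.cast_sub (by omega)]
    push_cast
    ring

end BlockFading

theorem theorem2 (m B N K M : ℕ) (hm : 0 < m) (hN : 0 < N) (hK : 0 < K) (hB : B = K * N)
    (X : Finset ℂ) (hcard : X.card = 2 ^ M) (hX : IsNormalized X)
    (U : Fin K → Matrix (Fin N) (Fin N) ℂ)
    (hU : ∀ k, U k ∈ Matrix.unitaryGroup (Fin N) ℂ) (hdiv : ∀ k, IsFullDiversity X (U k))
    (R : ℝ) (hR0 : 0 < R) (hRM : R < M) (de : ℝ) (hde : 0 < de) :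
    HasOutageExponent m X U R de
        (m * dSBrot B N M R * (1 + m * dSBrot B N M R * de)) ∧
      (N = B → HasOutageExponent m X U R de (m * B * (1 + m * B * de))) ∧
      (∀ (X' : Finset ℂ) (V : Fin 1 → Matrix (Fin B) (Fin B) ℂ), IsNormalized X' →
        V 0 ∈ Matrix.unitaryGroup (Fin B) ℂ →
        ∀ ε > 0, ∀ᶠ ρ : ℝ in atTop,
          ρ ^ (-((m : ℝ) * B * (1 + m * B * de) + ε)) ≤ minOutage m X' V R de ρ) := by
  obtain ⟨c, hc1, hcK, hcR, hcR', hd⟩ := exists_ceil_rate hN hK hR0 hRM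
  rw [← hB] at hd
  have hM : 0 < M := by
    have : (0 : ℝ) < M := hR0.trans hRM
    exact_mod_cast this
  have hX1 : 1 < X.card := by rw [hcard]; exact Nat.one_lt_two_pow hM.ne'
  have hlog : Real.logb 2 X.card = M := by
    rw [hcard, Nat.cast_pow, Nat.cast_ofNat, Real.logb_pow, Real.logb_self_eq_one one_lt_two, mul_one]
  have hexp : HasOutageExponent m X U R de
      (m * dSBrot B N M R * (1 + m * dSBrot B N M R * de)) := by
    set D : ℕ := m * ((K + 1 - c) * N) with hD
    have hDd : (m : ℝ) * dSBrot B N M R = D := by rw [hd, hD]; push_cast; ring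
    rw [hDd]
    obtain ⟨G, -, hG⟩ := Finset.exists_subset_card_eq
      (s := (Finset.univ : Finset (Fin K))) (n := K + 1 - c)
      (by rw [Finset.card_univ, Fintype.card_fin]; omega)
    obtain ⟨C, hC, hlow⟩ := exists_const_mul_rpow_le_minOutage hm hN
      (Finset.card_pos.1 (zero_lt_one.trans hX1)) U (R := R) hde
      (G := G) (Finset.card_pos.1 (by omega)) (by
        rw [hG, hlog, Nat.cast_sub (by omega)]
        push_cast
        refine lt_of_eq_of_lt ?_ hcR'
        ring) (D := D) (by rw [hG])
    exact tendsto_neg_log_div_log hC hlow fun ε hε =>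
      eventually_minOutage_le hm hK hN hX1 hdiv (by rwa [hlog]) hcK (by rwa [hlog]) hde hD hε
  refine ⟨hexp, fun hNB => ?_, fun X' V hX' _ ε hε => ?_⟩
  · have hK1 : K = 1 := by
      have : K * N = 1 * N := by rw [← hB, one_mul, hNB]
      exact Nat.eq_of_mul_eq_mul_right hN this
    have hc' : c = 1 := by omega
    have hdB : dSBrot B N M R = B := by
      rw [hd, hc', hK1, ← hNB]; norm_num
    rwa [hdB] at hexp
  -- An empty constellation would have energy `0`. The bound is then the converse with one group of
  -- dimension `B`, all of it faded: no group remains to carry the positive rate `R`.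
  · have hne : X'.Nonempty := by
      by_contra h
      rw [Finset.not_nonempty_iff_eq_empty] at h
      have := hX'.2
      simp [h] at this
    have hBpos : 0 < B := by rw [hB]; exact Nat.mul_pos hK hN
    obtain ⟨C, hC, hlow⟩ := exists_const_mul_rpow_le_minOutage (K := 1) hm hBpos hne V (R := R) hde
      (G := Finset.univ) Finset.univ_nonempty (by simpa using hR0) (D := m * (1 * B)) (by simp)
    have hpow := eventually_const_mul_rpow_le (C := 1)
      (a := -((m : ℝ) * B * (1 + m * B * de) + ε)) (b := -((m : ℝ) * B * (1 + m * B * de)))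
      (by linarith) hC
    filter_upwards [hlow, hpow] with ρ h1 h2
    rw [one_mul] at h2
    refine h2.trans (le_trans (le_of_eq ?_) h1)
    push_cast
    rw [one_mul]
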